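/- Let $(A,\mathfrak m)$ be a Noetherian local ring of Krull dimension two that is Cohen-Macaulay and whose associated graded ring $G(A)=\bigoplus_{n\ge 0}\mathfrak m^n/\mathfrak m^{n+1}$ is Cohen-Macaulay. Assume that $A$ is not an isolated singularity, i.e. there is a prime ideal $P\neq\mathfrak m$ such that the local ring $A_P$ is not regular. Then there exists a maximal Cohen-Macaulay $A$-module $M$ (a finitely generated Cohen-Macaulay $A$-module with $\dim M=\dim A$) such that the associated graded module $G(M)=\bigoplus_{n\ge 0}\mathfrak m^nM/\mathfrak m^{n+1}M$ is a Cohen-Macaulay $G(A)$-module and $\dim_A \operatorname{Ext}^1_A(M,M)\ge 1$, where the dimension is the Krull dimension of the support. -/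

import Mathlib

universe u v

open DirectSum

noncomputable section

namespace AssocGraded

variable {A : Type u} [CommRing A] (I : Ideal A) (M : Type v) [AddCommGroup M] [Module A M]

/-- The submodule `I ^ n M` of `M`. -/
abbrev powSMul (n : ℕ) : Submodule A M := I ^ n • (⊤ : Submodule A M)

/-- The `n`-th homogeneous component `I ^ n M / I ^ (n + 1) M`. -/
abbrev Piece (n : ℕ) : Type v :=
  ↥(powSMul I M n) ⧸ (powSMul I M (n + 1)).submoduleOf (powSMul I M n)

variable {M}

/-- The class in `I ^ n M / I ^ (n + 1) M` of an element of `I ^ n M`. -/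
def mk (n : ℕ) (x : M) (hx : x ∈ powSMul I M n) : Piece I M n :=
  Submodule.Quotient.mk ⟨x, hx⟩

variable {I}

theorem smul_mem_powSMul {i j : ℕ} {a : A} {x : M} (ha : a ∈ powSMul I A i)
    (hx : x ∈ powSMul I M j) : a • x ∈ powSMul I M (i + j) := by
  have ha' : a ∈ I ^ i := by simpa using ha
  rw [powSMul, pow_add, mul_smul]
  exact Submodule.smul_mem_smul ha' hx

variable (I M)

/-- The product `I ^ i × I ^ j M → I ^ (i + j) M`. -/
def preSMul (i j : ℕ) : ↥(powSMul I A i) →ₗ[A] ↥(powSMul I M j) →ₗ[A] ↥(powSMul I M (i + j)) :=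
  LinearMap.mk₂ A (fun a x => ⟨(a : A) • (x : M), smul_mem_powSMul a.2 x.2⟩)
    (fun a b x => Subtype.ext (add_smul (a : A) (b : A) (x : M)))
    (fun c a x => Subtype.ext (smul_assoc c (a : A) (x : M)))
    (fun a x y => Subtype.ext (smul_add (a : A) (x : M) (y : M)))
    (fun c a x => Subtype.ext (smul_comm (a : A) c (x : M)))

/-- The product `I ^ i / I ^ (i + 1) × I ^ j M / I ^ (j + 1) M → I ^ (i + j) M / I ^ (i + j + 1) M`
induced by the scalar multiplication of `M`. -/
def pieceSMul (i j : ℕ) : Piece I A i →ₗ[A] Piece I M j →ₗ[A] Piece I M (i + j) :=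
  Submodule.liftQ _
    { toFun := fun a => Submodule.mapQ _ _ (preSMul I M i j a) (by
        intro x hx
        exact smul_mem_powSMul (I := I) (i := i) (j := j + 1) a.2 hx)
      map_add' := fun a b => by
        refine LinearMap.ext fun x => ?_
        obtain ⟨x, rfl⟩ := Submodule.Quotient.mk_surjective _ x
        exact congrArg Submodule.Quotient.mk (LinearMap.map_add₂ (preSMul I M i j) a b x)
      map_smul' := fun c a => by
        refine LinearMap.ext fun x => ?_
        obtain ⟨x, rfl⟩ := Submodule.Quotient.mk_surjective _ x
        exact congrArg Submodule.Quotient.mk (LinearMap.map_smul₂ (preSMul I M i j) c a x) }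
    (by
      intro a ha
      refine LinearMap.ext fun x => ?_
      obtain ⟨x, rfl⟩ := Submodule.Quotient.mk_surjective _ x
      refine (Submodule.Quotient.mk_eq_zero _).2 ?_
      have h := smul_mem_powSMul (I := I) (i := i + 1) (j := j) ha x.2
      rw [show i + 1 + j = i + j + 1 by omega] at h
      exact h)

variable {I M}

theorem exists_mk {n : ℕ} (y : Piece I M n) : ∃ x hx, y = mk I n x hx := by
  obtain ⟨⟨x, hx⟩, rfl⟩ := Submodule.Quotient.mk_surjective _ y
  exact ⟨x, hx, rfl⟩

theorem pieceSMul_mk {i j : ℕ} {a : A} {x : M} (ha : a ∈ powSMul I A i)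
    (hx : x ∈ powSMul I M j) :
    pieceSMul I M i j (mk I i a ha) (mk I j x hx) =
      mk I (i + j) (a • x) (smul_mem_powSMul ha hx) := rfl

theorem gradedMk_eq {i j : ℕ} (h : i = j) {x y : M} (hxy : x = y) (hx : x ∈ powSMul I M i)
    (hy : y ∈ powSMul I M j) :
    (GradedMonoid.mk i (mk I i x hx) : GradedMonoid (Piece I M)) =
      GradedMonoid.mk j (mk I j y hy) := by
  subst h; subst hxy; rfl

theorem one_mem_powSMul : (1 : A) ∈ powSMul I A 0 := by simp

instance : GradedMonoid.GMul (Piece I A) where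
  mul a b := pieceSMul I A _ _ a b

instance : GradedMonoid.GOne (Piece I A) where
  one := mk I 0 1 one_mem_powSMul

instance : GradedMonoid.GMonoid (Piece I A) where
  one_mul := by
    rintro ⟨i, a⟩
    obtain ⟨a, ha, rfl⟩ := exists_mk a
    exact gradedMk_eq (zero_add i) (one_smul A a) _ _
  mul_one := by
    rintro ⟨i, a⟩
    obtain ⟨a, ha, rfl⟩ := exists_mk a
    exact gradedMk_eq (add_zero i) (mul_one a) _ _
  mul_assoc := by
    rintro ⟨i, a⟩ ⟨j, b⟩ ⟨k, c⟩
    obtain ⟨a, ha, rfl⟩ := exists_mk a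
    obtain ⟨b, hb, rfl⟩ := exists_mk b
    obtain ⟨c, hc, rfl⟩ := exists_mk c
    exact gradedMk_eq (add_assoc i j k) (mul_assoc a b c) _ _

instance : DirectSum.GCommRing (Piece I A) where
  mul_zero a := map_zero (pieceSMul I A _ _ a)
  zero_mul b := by
    change pieceSMul I A _ _ 0 b = 0
    simp
  mul_add a b c := map_add (pieceSMul I A _ _ a) b c
  add_mul a b c := by
    change pieceSMul I A _ _ (a + b) c = pieceSMul I A _ _ a c + pieceSMul I A _ _ b c
    simp
  natCast n := n • mk I 0 1 one_mem_powSMul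
  natCast_zero := zero_nsmul _
  natCast_succ n := succ_nsmul _ n
  intCast n := n • mk I 0 1 one_mem_powSMul
  intCast_ofNat n := natCast_zsmul _ n
  intCast_negSucc_ofNat n := negSucc_zsmul _ n
  mul_comm := by
    rintro ⟨i, a⟩ ⟨j, b⟩
    obtain ⟨a, ha, rfl⟩ := exists_mk a
    obtain ⟨b, hb, rfl⟩ := exists_mk b
    exact gradedMk_eq (add_comm i j) (mul_comm a b) _ _

instance : DirectSum.Gmodule (Piece I A) (Piece I M) where
  smul a x := pieceSMul I M _ _ a x
  one_smul := by
    rintro ⟨i, x⟩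
    obtain ⟨x, hx, rfl⟩ := exists_mk x
    exact gradedMk_eq (zero_add i) (one_smul A x) _ _
  mul_smul := by
    rintro ⟨i, a⟩ ⟨j, b⟩ ⟨k, x⟩
    obtain ⟨a, ha, rfl⟩ := exists_mk a
    obtain ⟨b, hb, rfl⟩ := exists_mk b
    obtain ⟨x, hx, rfl⟩ := exists_mk x
    exact gradedMk_eq (add_assoc i j k) (mul_smul a b x) _ _
  smul_add a x y := map_add (pieceSMul I M _ _ a) x y
  smul_zero a := map_zero (pieceSMul I M _ _ a)
  add_smul a b x := by
    change pieceSMul I M _ _ (a + b) x = pieceSMul I M _ _ a x + pieceSMul I M _ _ b x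
    simp
  zero_smul x := by
    change pieceSMul I M _ _ 0 x = 0
    simp

end AssocGraded

/-- The associated graded ring `⨁ n, I ^ n / I ^ (n + 1)` of `A` with respect to `I`. -/
def AssocGradedRing {A : Type u} [CommRing A] (I : Ideal A) : Type u :=
  ⨁ n, AssocGraded.Piece I A n

instance {A : Type u} [CommRing A] (I : Ideal A) : CommRing (AssocGradedRing I) :=
  inferInstanceAs (CommRing (⨁ n, AssocGraded.Piece I A n))

/-- The associated graded module `⨁ n, I ^ n M / I ^ (n + 1) M` of `M` with respect to `I`. -/
def AssocGradedModule {A : Type u} [CommRing A] (I : Ideal A) (M : Type v) [AddCommGroup M]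
    [Module A M] : Type v :=
  ⨁ n, AssocGraded.Piece I M n

instance {A : Type u} [CommRing A] (I : Ideal A) (M : Type v) [AddCommGroup M] [Module A M] :
    AddCommGroup (AssocGradedModule I M) :=
  inferInstanceAs (AddCommGroup (⨁ n, AssocGraded.Piece I M n))

instance {A : Type u} [CommRing A] (I : Ideal A) (M : Type v) [AddCommGroup M] [Module A M] :
    Module (AssocGradedRing I) (AssocGradedModule I M) :=
  inferInstanceAs (Module (⨁ n, AssocGraded.Piece I A n) (⨁ n, AssocGraded.Piece I M n))

/-- The depth of a module over a local ring: the supremum of the lengths of the regular sequences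
on `M` that lie in the maximal ideal. -/
def localDepth (R : Type u) [CommRing R] [IsLocalRing R] (M : Type v) [AddCommGroup M]
    [Module R M] : ℕ∞ :=
  ⨆ (rs : List R) (_ : ∀ r ∈ rs, r ∈ IsLocalRing.maximalIdeal R)
    (_ : RingTheory.Sequence.IsRegular M rs), (rs.length : ℕ∞)

/-- A finitely generated module over a Noetherian local ring is Cohen-Macaulay if it is zero or
its depth equals its dimension. -/
def IsLocalCohenMacaulay (R : Type u) [CommRing R] [IsLocalRing R] (M : Type v) [AddCommGroup M]
    [Module R M] : Prop :=
  Nontrivial M → (localDepth R M : WithBot ℕ∞) = Module.supportDim R M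

/-- A finitely generated module over a Noetherian ring is Cohen-Macaulay if its localizations at
all maximal ideals are Cohen-Macaulay. A ring is Cohen-Macaulay if it is so as a module over
itself. -/
def IsCohenMacaulay (R : Type u) [CommRing R] (M : Type v) [AddCommGroup M] [Module R M] : Prop :=
  ∀ (p : Ideal R) [p.IsMaximal],
    IsLocalCohenMacaulay (Localization.AtPrime p) (LocalizedModule p.primeCompl M)

/-- A maximal Cohen-Macaulay module over a Noetherian local ring: a finitely generated
Cohen-Macaulay module of dimension `dim A`. -/
structure IsMaximalCohenMacaulay (A : Type u) [CommRing A] [IsLocalRing A] (M : Type v)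
    [AddCommGroup M] [Module A M] : Prop where
  finite : Module.Finite A M
  cohenMacaulay : IsLocalCohenMacaulay A M
  dim_eq : Module.supportDim A M = ringKrullDim A

/-- A Noetherian local ring is an isolated singularity if its localizations at all non-maximal
primes are regular (regular local rings are included). -/
def IsIsolatedSingularity (A : Type u) [CommRing A] [IsLocalRing A] : Prop :=
  ∀ (p : Ideal A) [p.IsPrime], p ≠ IsLocalRing.maximalIdeal A →
    IsRegularLocalRing (Localization.AtPrime p)

end

/-!
Let `P` be a non-maximal prime with `A_P` not regular, put `Q = 𝔪 ^ n (A ⧸ P)` for large `n`, and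
let `M` be the first syzygy module of `Q`, that is the kernel of a minimal free cover `F → Q`.

*Depth.* As `A ⧸ P` is a domain and `P ≠ 𝔪`, `𝔪` is not associated to `Q`, so `M` has depth at least
`min 2 (depth A) = depth A`. For `n` large, Artin-Rees makes the relations of `Q` linear:
`M ∩ 𝔪 ^ (j + 1) F = 𝔪 ^ j M`. Hence `G(M)` is, up to a shift, the kernel of `G(F) → G(Q)`; also by
Artin-Rees, no maximal ideal of `G(A)` is associated to `G(Q)` for large `n`, and the same depth
argument applies to `G(M)` once `dim G(A) ≤ dim A` is known.

*Support of `Ext¹(M, M)`.* If `P` is not in the support, then every map `M → Q` lifts to `F` up to a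
factor outside `P`. Composing a map `l : P → A ⧸ P` with `M → P` and `A ⧸ P → Q`, the maps coming
from a lift of `F → Q ⊆ A ⧸ P` to `A` and from an element of `Q`, and lifting the composite, one
obtains a map `θ : P → A` inducing a nonzero multiple of `l`. So either all `l` vanish, and then
`P` is annihilated by an element outside `P` and `A_P` is a field, or some `θ p` lies outside `P`,
and then `p` is a regular generator of the maximal ideal of `A_P`. Both contradict the choice of
`P`, so the support contains the chain `P < 𝔪`.
-/

section AssociatedPrimes

variable {R : Type*} [CommRing R] [IsNoetherianRing R] {L : Type*} [AddCommGroup L] [Module R L]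
  {p : Ideal R} [p.IsMaximal]

theorem mem_associatedPrimes_iff_exists_ne_zero :
    p ∈ associatedPrimes R L ↔ ∃ t : L, t ≠ 0 ∧ ∀ a ∈ p, a • t = 0 := by
  rw [AssociatedPrimes.mem_iff, isAssociatedPrime_iff, and_iff_right ‹p.IsMaximal›.isPrime]
  simp only [SetLike.ext_iff, Submodule.mem_colon_singleton, Submodule.mem_bot]
  constructor
  · rintro ⟨t, ht⟩
    refine ⟨t, ?_, fun a ha => (ht a).1 ha⟩
    rintro rfl
    exact (Ideal.ne_top_iff_one p).1 ‹p.IsMaximal›.ne_top ((ht 1).2 (smul_zero 1))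
  · rintro ⟨t, ht, hp⟩
    have hle : p ≤ LinearMap.ker (LinearMap.toSpanSingleton R L t) := hp
    have hne : LinearMap.ker (LinearMap.toSpanSingleton R L t) ≠ ⊤ := fun h =>
      ht (by simpa using (Ideal.eq_top_iff_one _).1 h)
    exact ⟨t, fun a => SetLike.ext_iff.1 (‹p.IsMaximal›.eq_of_le hne hle) a⟩

theorem exists_isSMulRegular_mem_iff_notMem_associatedPrimes [Module.Finite R L] :
    (∃ r ∈ p, IsSMulRegular L r) ↔ p ∉ associatedPrimes R L := by
  rw [← not_iff_not, not_not]
  calc (¬∃ r ∈ p, IsSMulRegular L r) ↔ (p : Set R) ⊆ ⋃ q ∈ associatedPrimes R L, q := by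
        rw [biUnion_associatedPrimes_eq_compl_regular]
        simp [Set.subset_def]
    _ ↔ ∃ q ∈ associatedPrimes R L, p ≤ q :=
        Ideal.subset_union_prime_finite (associatedPrimes.finite R L) (f := id) ⊤ ⊤
          fun q hq _ _ => IsAssociatedPrime.isPrime hq
    _ ↔ p ∈ associatedPrimes R L := by
        refine ⟨fun ⟨q, hq, hpq⟩ => ?_, fun hp => ⟨p, hp, le_rfl⟩⟩
        rwa [‹p.IsMaximal›.eq_of_le (IsAssociatedPrime.isPrime hq).ne_top hpq]

open scoped Pointwise in
/-- If `x t = r v` for an element `t` whose class in `L / rL` is annihilated by `p`, then the class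
of `v` in `L / xL` is annihilated by `p` as well. -/
theorem mem_associatedPrimes_quotSMulTop_of_isSMulRegular {x r : R} (hx : x ∈ p)
    (hxL : IsSMulRegular L x) (hrL : IsSMulRegular L r)
    (h : p ∈ associatedPrimes R (QuotSMulTop r L)) : p ∈ associatedPrimes R (QuotSMulTop x L) := by
  have smul_mk_eq_zero (a b : R) (t : L) :
      a • (Submodule.Quotient.mk t : QuotSMulTop b L) = 0 ↔ ∃ v, b • v = a • t := by
    rw [← Submodule.Quotient.mk_smul, Submodule.Quotient.mk_eq_zero,
      Submodule.mem_smul_pointwise_iff_exists]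
    simp
  have mk_eq_zero (b : R) (t : L) :
      (Submodule.Quotient.mk t : QuotSMulTop b L) = 0 ↔ ∃ v, b • v = t := by
    simpa using smul_mk_eq_zero 1 b t
  rw [mem_associatedPrimes_iff_exists_ne_zero] at h ⊢
  obtain ⟨t, ht, hpt⟩ := h
  obtain ⟨t, rfl⟩ := Submodule.Quotient.mk_surjective _ t
  obtain ⟨v, hv⟩ := (smul_mk_eq_zero x r t).1 (hpt x hx)
  refine ⟨Submodule.Quotient.mk v, fun hv0 => ht ?_, fun a ha => ?_⟩
  · obtain ⟨w, rfl⟩ := (mk_eq_zero x v).1 hv0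
    exact (mk_eq_zero r t).2 ⟨w, hxL ((smul_comm x r w).trans hv)⟩
  · obtain ⟨c, hc⟩ := (smul_mk_eq_zero a r t).1 (hpt a ha)
    exact (smul_mk_eq_zero a x v).2 ⟨c, hrL <|
      calc r • x • c = x • a • t := by rw [smul_comm, hc]
        _ = r • a • v := by rw [smul_comm, ← hv, smul_comm]⟩

end AssociatedPrimes

theorem injective_quotSMulTop_map {R : Type*} [CommRing R] {K F T : Type*} [AddCommGroup K]
    [Module R K] [AddCommGroup F] [Module R F] [AddCommGroup T] [Module R T] {f : K →ₗ[R] F}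
    {g : F →ₗ[R] T} (hf : Function.Injective f) (hfg : Function.Exact f g) {r : R}
    (hr : IsSMulRegular T r) : Function.Injective (QuotSMulTop.map r f) := by
  have hexact := QuotSMulTop.map_first_exact_on_four_term_exact_of_isSMulRegular_last
    ((LinearMap.exact_zero_iff_injective PUnit f).2 hf) hfg hr
  rwa [map_zero, LinearMap.exact_zero_iff_injective] at hexact

section Depth

open IsLocalRing RingTheory.Sequence

section General

variable {R : Type u} [CommRing R] [IsLocalRing R]

theorem length_le_localDepth {L : Type v} [AddCommGroup L] [Module R L] {rs : List R}
    (hrs : ∀ r ∈ rs, r ∈ maximalIdeal R) (hreg : IsRegular L rs) :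
    (rs.length : ℕ∞) ≤ localDepth R L :=
  le_iSup₂_of_le rs hrs (le_iSup_of_le hreg le_rfl)

theorem exists_isRegular_of_lt_localDepth {L : Type v} [AddCommGroup L] [Module R L] {n : ℕ}
    (h : n < localDepth R L) :
    ∃ rs : List R, (∀ r ∈ rs, r ∈ maximalIdeal R) ∧ IsRegular L rs ∧ n < rs.length := by
  simp only [localDepth, lt_iSup_iff, Nat.cast_lt, exists_prop] at h
  exact h

theorem localDepth_le_of_linearEquiv {L L' : Type*} [AddCommGroup L] [Module R L]
    [AddCommGroup L'] [Module R L'] (e : L ≃ₗ[R] L') : localDepth R L ≤ localDepth R L' :=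
  iSup₂_le fun rs hrs => iSup_le fun hreg =>
    length_le_localDepth hrs ((e.isRegular_congr rs).1 hreg)

theorem IsLocalCohenMacaulay.of_linearEquiv {L L' : Type*} [AddCommGroup L] [Module R L]
    [AddCommGroup L'] [Module R L'] (e : L ≃ₗ[R] L') (h : IsLocalCohenMacaulay R L) :
    IsLocalCohenMacaulay R L' := by
  intro hL'
  have := e.toEquiv.nontrivial
  rw [← Module.supportDim_eq_of_equiv e, ← h this,
    le_antisymm (localDepth_le_of_linearEquiv e) (localDepth_le_of_linearEquiv e.symm)]

theorem localDepth_self_le_of_flat {L : Type v} [AddCommGroup L] [Module R L] [Module.Finite R L]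
    [Nontrivial L] [Module.Flat R L] : localDepth R R ≤ localDepth R L :=
  iSup₂_le fun rs hrs => iSup_le fun hreg => length_le_localDepth hrs <|
    .of_isWeaklyRegular_of_mem_maximalIdeal _ hrs <|
      ((TensorProduct.rid R L).isWeaklyRegular_congr rs).1 hreg.1.isWeaklyRegular_lTensor

end General

variable {R : Type u} [CommRing R] [IsLocalRing R] [IsNoetherianRing R] {L : Type v}
  [AddCommGroup L] [Module R L] [Module.Finite R L] [Nontrivial L]

theorem localDepth_le_supportDim : (localDepth R L : WithBot ℕ∞) ≤ Module.supportDim R L := by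
  obtain ⟨d, hd⟩ := WithBot.ne_bot_iff_exists.1 (Module.supportDim_ne_bot_of_nontrivial R L)
  rw [← hd, WithBot.coe_le_coe]
  refine iSup₂_le fun rs _ => iSup_le fun hreg => ?_
  have hne : Nontrivial (L ⧸ Ideal.ofList rs • (⊤ : Submodule R L)) :=
    hreg.quot_ofList_smul_nontrivial ⊤
  obtain ⟨e, he⟩ := WithBot.ne_bot_iff_exists.1 (Module.supportDim_ne_bot_of_nontrivial R
    (L ⧸ Ideal.ofList rs • (⊤ : Submodule R L)))
  have hdim := Module.supportDim_add_length_eq_supportDim_of_isRegular rs hreg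
  rw [← hd, ← he] at hdim
  exact le_of_le_of_eq le_add_self (WithBot.coe_injective hdim)

theorem localDepth_pos_iff : 0 < localDepth R L ↔ maximalIdeal R ∉ associatedPrimes R L := by
  rw [← exists_isSMulRegular_mem_iff_notMem_associatedPrimes]
  constructor
  · intro h
    obtain ⟨_ | ⟨r, rs⟩, hrs, hreg, hlen⟩ := exists_isRegular_of_lt_localDepth (n := 0) h
    · simp at hlen
    · exact ⟨r, hrs r List.mem_cons_self, ((isRegular_cons_iff L r rs).1 hreg).1⟩
  · rintro ⟨r, hr, hreg⟩
    have hmem : ∀ a ∈ [r], a ∈ maximalIdeal R := List.forall_mem_singleton.2 hr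
    exact zero_lt_one.trans_le (length_le_localDepth hmem
      (.of_isWeaklyRegular_of_mem_maximalIdeal _ hmem ((isWeaklyRegular_singleton_iff L r).2 hreg)))

theorem one_lt_localDepth_iff {r : R} (hr : r ∈ maximalIdeal R) (hreg : IsSMulRegular L r) :
    1 < localDepth R L ↔ maximalIdeal R ∉ associatedPrimes R (QuotSMulTop r L) := by
  constructor
  · intro h
    obtain ⟨_ | ⟨x, _ | ⟨y, rs⟩⟩, hrs, hregxy, hlen⟩ := exists_isRegular_of_lt_localDepth (n := 1) h
    · simp at hlen
    · simp at hlen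
    · obtain ⟨hx, hregy⟩ := (isRegular_cons_iff L x (y :: rs)).1 hregxy
      have hy := ((isRegular_cons_iff _ y rs).1 hregy).1
      have hxm := exists_isSMulRegular_mem_iff_notMem_associatedPrimes.1 ⟨y, hrs y (by simp), hy⟩
      exact fun hrm => hxm
        (mem_associatedPrimes_quotSMulTop_of_isSMulRegular (hrs x List.mem_cons_self) hx hreg hrm)
  · rw [← exists_isSMulRegular_mem_iff_notMem_associatedPrimes]
    rintro ⟨z, hz, hzreg⟩
    have hmem : ∀ a ∈ [r, z], a ∈ maximalIdeal R :=
      List.forall_mem_cons.2 ⟨hr, List.forall_mem_singleton.2 hz⟩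
    refine lt_of_lt_of_le (by norm_num) (length_le_localDepth hmem ?_)
    exact .of_isWeaklyRegular_of_mem_maximalIdeal _ hmem
      (.cons hreg ((isWeaklyRegular_singleton_iff _ z).2 hzreg))

section Syzygy

variable {K F T : Type*} [AddCommGroup K] [Module R K] [Nontrivial K]
  [AddCommGroup F] [Module R F] [Module.Finite R F] [AddCommGroup T] [Module R T]
  {f : K →ₗ[R] F} {g : F →ₗ[R] T}

theorem min_localDepth_two_le_localDepth (hf : Function.Injective f) (hfg : Function.Exact f g)
    (hT : maximalIdeal R ∉ associatedPrimes R T) : min (localDepth R F) 2 ≤ localDepth R K := by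
  have hK : Module.Finite R K := .of_injective f hf
  have hF : Nontrivial F := hf.nontrivial
  have hgT : maximalIdeal R ∉ associatedPrimes R (LinearMap.range g) := fun h =>
    hT (associatedPrimes.subset_of_injective (LinearMap.range g).injective_subtype h)
  obtain hd0 | hd0 := eq_zero_or_pos (localDepth R F)
  · simp [hd0]
  have hassF := localDepth_pos_iff.1 hd0
  have hK0 : 0 < localDepth R K :=
    localDepth_pos_iff.2 fun h => hassF (associatedPrimes.subset_of_injective hf h)
  obtain hd1 | hd1 := le_or_gt (localDepth R F) 1
  · exact (min_le_left _ _).trans (hd1.trans (Order.one_le_iff_pos.2 hK0))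
  obtain ⟨r, hr, hreg⟩ := exists_isSMulRegular_mem_iff_notMem_associatedPrimes.2
    (show maximalIdeal R ∉ associatedPrimes R (F × LinearMap.range g) by
      simp [associatedPrimes.prod, hassF, hgT])
  have hrF : IsSMulRegular F r := hreg.of_injective (LinearMap.inl R F _) LinearMap.inl_injective
  have hrg : IsSMulRegular (LinearMap.range g) r :=
    hreg.of_injective (LinearMap.inr R F _) LinearMap.inr_injective
  have hfg' : Function.Exact f g.rangeRestrict := fun x => by
    rw [← hfg x]
    exact Subtype.ext_iff
  have hK1 : 1 < localDepth R K :=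
    (one_lt_localDepth_iff hr (hrF.of_injective f hf)).2 fun h =>
      (one_lt_localDepth_iff hr hrF).1 hd1
        (associatedPrimes.subset_of_injective (injective_quotSMulTop_map hf hfg' hrg) h)
  exact (min_le_right _ _).trans (Order.add_one_le_of_lt hK1)

theorem supportDim_eq_and_isLocalCohenMacaulay_of_syzygy (hR : IsLocalCohenMacaulay R R)
    (hdim : ringKrullDim R ≤ 2) [Module.Flat R F] (hf : Function.Injective f)
    (hfg : Function.Exact f g) (hT : maximalIdeal R ∉ associatedPrimes R T) :
    Module.supportDim R K = ringKrullDim R ∧ IsLocalCohenMacaulay R K := by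
  have hK : Module.Finite R K := .of_injective f hf
  have hF : Nontrivial F := hf.nontrivial
  have hRd := hR inferInstance
  rw [Module.supportDim_self_eq_ringKrullDim] at hRd
  have hR2 : localDepth R R ≤ 2 := WithBot.coe_le_coe.1 (hRd.trans_le hdim)
  have hle : ringKrullDim R ≤ localDepth R K := by
    rw [← hRd, WithBot.coe_le_coe]
    exact (le_min localDepth_self_le_of_flat hR2).trans (min_localDepth_two_le_localDepth hf hfg hT)
  have hdimK : Module.supportDim R K = ringKrullDim R :=
    (Module.supportDim_le_ringKrullDim R K).antisymm (hle.trans localDepth_le_supportDim)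
  exact ⟨hdimK, fun _ => localDepth_le_supportDim.antisymm (hdimK.trans_le hle)⟩

end Syzygy

end Depth

open Module.associatedPrimes in
theorem IsCohenMacaulay.of_syzygy {G : Type u} [CommRing G] [IsNoetherianRing G]
    (hG : IsCohenMacaulay G G) (hdim : ringKrullDim G ≤ 2) {K : Type v} {F T : Type*}
    [AddCommGroup K] [Module G K] [AddCommGroup F] [Module G F] [Module.Finite G F]
    [Module.Flat G F] [AddCommGroup T] [Module G T] {f : K →ₗ[G] F} {g : F →ₗ[G] T}
    (hf : Function.Injective f) (hfg : Function.Exact f g)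
    (hT : ∀ p : Ideal G, p.IsMaximal → p ∉ associatedPrimes G T) : IsCohenMacaulay G K := by
  intro p hp hK
  let S := p.primeCompl
  let κ := LocalizedModule.mkLinearMap S K
  let φ := LocalizedModule.mkLinearMap S F
  let τ := LocalizedModule.mkLinearMap S T
  have hR : IsLocalCohenMacaulay (Localization.AtPrime p) (Localization.AtPrime p) :=
    (hG p).of_linearEquiv ((IsLocalizedModule.linearEquiv S
      (LocalizedModule.mkLinearMap S G)
      (Algebra.linearMap G (Localization.AtPrime p))).extendScalarsOfIsLocalization S
        (Localization.AtPrime p))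
  have hd : ringKrullDim (Localization.AtPrime p) ≤ 2 := by
    rw [IsLocalization.AtPrime.ringKrullDim_eq_height p]
    exact (Ideal.height_le_ringKrullDim_of_ne_top hp.ne_top).trans hdim
  have hTp : IsLocalRing.maximalIdeal (Localization.AtPrime p) ∉
      associatedPrimes (Localization.AtPrime p) (LocalizedModule S T) := by
    have hunder := Localization.AtPrime.under_maximalIdeal (I := p)
    intro h
    rw [← preimage_comap_associatedPrimes_eq_associatedPrimes_of_isLocalizedModule S _ τ] at h
    exact hT p hp (hunder ▸ h)
  exact (supportDim_eq_and_isLocalCohenMacaulay_of_syzygy hR hd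
    (f := IsLocalizedModule.mapExtendScalars S κ φ (Localization.AtPrime p) f)
    (g := IsLocalizedModule.mapExtendScalars S φ τ (Localization.AtPrime p) g)
    (IsLocalizedModule.map_injective S κ φ f hf) (IsLocalizedModule.map_exact S κ φ τ f g hfg)
    hTp).2 hK

section Filtration

variable {A : Type*} [CommRing A] {I : Ideal A}

theorem smul_top_eq_pi {ι : Type*} [Finite ι] (J : Ideal A) (N : Type*) [AddCommGroup N]
    [Module A N] :
    J • (⊤ : Submodule A (ι → N)) = Submodule.pi Set.univ fun _ => J • (⊤ : Submodule A N) := by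
  classical
  cases nonempty_fintype ι
  refine le_antisymm (fun t ht i _ => Submodule.smul_top_le_comap_smul_top J (LinearMap.proj i) ht)
    fun t ht => ?_
  rw [← Finset.univ_sum_single t]
  exact Submodule.sum_mem _ fun i _ =>
    Submodule.smul_top_le_comap_smul_top J (LinearMap.single A (fun _ => N) i) (ht i trivial)

/-- The linear map `N ^ ι → N` that sends `t` to `∑ i, x i • t i`. -/
def weightedSum {ι : Type*} [Fintype ι] (x : ι → A) (N : Type*) [AddCommGroup N] [Module A N] :
    (ι → N) →ₗ[A] N :=
  ∑ i, x i • LinearMap.proj i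

section WeightedSum

variable {ι : Type*} [Fintype ι] (x : ι → A) {N N' : Type*} [AddCommGroup N] [Module A N]
  [AddCommGroup N'] [Module A N']

@[simp]
theorem weightedSum_apply (t : ι → N) : weightedSum x N t = ∑ i, x i • t i := by
  simp [weightedSum]

theorem weightedSum_comp_compLeft (φ : N →ₗ[A] N') :
    weightedSum x N' ∘ₗ φ.compLeft ι = φ ∘ₗ weightedSum x N := by
  ext t
  simp

theorem map_weightedSum_pi (P : Submodule A N) :
    (Submodule.pi Set.univ fun _ => P).map (weightedSum x N) = Ideal.span (Set.range x) • P := by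
  classical
  refine le_antisymm (Submodule.map_le_iff_le_comap.2 fun t ht => ?_)
    (Submodule.smul_le.2 fun a ha y hy => ?_)
  · rw [Submodule.mem_comap, weightedSum_apply]
    exact Submodule.sum_mem _ fun i _ =>
      Submodule.smul_mem_smul (Ideal.subset_span ⟨i, rfl⟩) (ht i trivial)
  · obtain ⟨c, rfl⟩ := Ideal.mem_span_range_iff_exists_fun.1 ha
    refine ⟨fun i => c i • y, fun i _ => P.smul_mem _ hy, ?_⟩
    simp [Finset.sum_smul, mul_smul, smul_comm (x _) (c _)]

end WeightedSum

section ArtinRees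

variable [IsNoetherianRing A] {N N' : Type*} [AddCommGroup N] [Module A N] [Module.Finite A N]
  [AddCommGroup N'] [Module A N']

variable (I) in
theorem exists_forall_smul_inf_iInf_comap_eq {ι : Type*} (φ : ι → N →ₗ[A] N') (c : ℕ) :
    ∃ n₀, ∀ n ≥ n₀, I • ((⨅ i, (I ^ (n + c) • ⊤ : Submodule A N').comap (φ i)) ⊓ I ^ n • ⊤) =
      (⨅ i, (I ^ (n + 1 + c) • ⊤ : Submodule A N').comap (φ i)) ⊓ I ^ (n + 1) • ⊤ := by
  let W : I.Filtration N :=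
    { N n := ⨅ i, (I ^ (n + c) • ⊤ : Submodule A N').comap (φ i)
      mono n := iInf_mono fun i =>
        Submodule.comap_mono (Submodule.pow_smul_top_le I N' (by omega))
      smul_le n := le_iInf fun i => Submodule.smul_le.2 fun a ha u hu => by
        rw [Submodule.mem_iInf] at hu
        rw [Submodule.mem_comap, map_smul, add_right_comm, pow_succ', mul_smul]
        exact Submodule.smul_mem_smul ha (hu i) }
  exact (I.stableFiltration_stable (⊤ : Submodule A N)).inter_left (F' := W)

variable (I N) in
theorem exists_forall_mem_pow_succ_smul_of_forall_smul_mem :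
    ∃ n₀, ∀ n ≥ n₀, ∀ u ∈ I ^ n • (⊤ : Submodule A N),
      (∀ a ∈ I, a • u ∈ I ^ (n + 2) • (⊤ : Submodule A N)) →
        u ∈ I ^ (n + 1) • (⊤ : Submodule A N) := by
  obtain ⟨n₀, hn₀⟩ :=
    exists_forall_smul_inf_iInf_comap_eq I (fun a : I => LinearMap.lsmul A N a) 2
  refine ⟨n₀ + 1, fun n hn u hu hIu => ?_⟩
  obtain ⟨n, rfl⟩ : ∃ k, n = k + 1 := ⟨n - 1, by omega⟩
  have hmem : u ∈ I • ((⨅ a : I, (I ^ (n + 2) • ⊤ : Submodule A N).comap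
      (LinearMap.lsmul A N a)) ⊓ I ^ n • ⊤) := by
    rw [hn₀ n (by omega)]
    exact ⟨Submodule.mem_iInf _ |>.2 fun a => hIu a a.2, hu⟩
  refine Submodule.smul_le.2 (fun a ha v hv => ?_) hmem
  exact (Submodule.mem_iInf _).1 (Submodule.mem_inf.1 hv).1 ⟨a, ha⟩

end ArtinRees

theorem smul_filtration_eq_of_le_sup {N : Type*} [AddCommGroup N] [Module A N]
    {𝓕 : I.Filtration N} (h𝓕 : 𝓕.Stable) {j₀ : ℕ}
    (hle : ∀ j ≥ j₀, 𝓕.N (j + 1) ≤ I • 𝓕.N j ⊔ 𝓕.N (j + 2)) {j : ℕ} (hj : j₀ ≤ j) :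
    I • 𝓕.N j = 𝓕.N (j + 1) := by
  have hiter (k : ℕ) : 𝓕.N (j + 1) ≤ I • 𝓕.N j ⊔ 𝓕.N (j + k + 2) := by
    induction k with
    | zero => exact hle j hj
    | succ k ih =>
      refine ih.trans (sup_le le_sup_left ((hle (j + k + 1) (by omega)).trans ?_))
      exact sup_le_sup (smul_mono_right _ (𝓕.antitone (by omega))) le_rfl
  obtain ⟨l, hl⟩ := h𝓕
  refine le_antisymm (𝓕.smul_le j) ((hiter l).trans (sup_le le_rfl ?_))
  rw [← hl (j + l + 1) (by omega)]
  exact smul_mono_right _ (𝓕.antitone (by omega))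

/-- A module `K ⊆ F` of linear relations: `F` induces on `K` the `I`-adic filtration of `K`, shifted
by one (in particular `K ⊆ I F`). For the kernel of a map `F → N` this makes the leading forms of
the relations in `K` a submodule of the associated graded module of `F` generated in degree one. -/
def IsLinearRelations (I : Ideal A) {F : Type*} [AddCommGroup F] [Module A F]
    (K : Submodule A F) : Prop :=
  ∀ j : ℕ, K ⊓ I ^ (j + 1) • ⊤ = I ^ j • K

section LinearPresentation

variable {N F : Type*} [AddCommGroup N] [Module A N] [AddCommGroup F] [Module A F]

theorem map_pow_smul_top_of_range_eq {π : F →ₗ[A] N} {n : ℕ} (hπ : LinearMap.range π = I ^ n • ⊤)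
    (k : ℕ) : (I ^ k • (⊤ : Submodule A F)).map π = I ^ (n + k) • ⊤ := by
  rw [Submodule.map_smul'', Submodule.map_top, hπ, ← mul_smul, ← pow_add, add_comm]

theorem comap_pow_smul_top_of_range_eq {π : F →ₗ[A] N} {n : ℕ}
    (hπ : LinearMap.range π = I ^ n • ⊤) (k : ℕ) :
    (I ^ (n + k) • (⊤ : Submodule A N)).comap π = I ^ k • ⊤ ⊔ LinearMap.ker π := by
  rw [← map_pow_smul_top_of_range_eq hπ, Submodule.comap_map_eq]

theorem ker_comp_inf_pow_smul_top_le {N' : Type*} [AddCommGroup N'] [Module A N'] {ρ : F →ₗ[A] N}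
    {ν : N →ₗ[A] N'} {n j : ℕ} (hρ : LinearMap.range ρ = I ^ n • ⊤) (Q : Submodule A N')
    (hν : LinearMap.ker ν ⊓ I ^ (n + (j + 1)) • ⊤ ≤ I • (Q.comap ν ⊓ I ^ (n + j) • ⊤)) :
    LinearMap.ker (ν ∘ₗ ρ) ⊓ I ^ (j + 1) • ⊤ ≤
      I • (Q.comap (ν ∘ₗ ρ) ⊓ I ^ j • ⊤) ⊔ LinearMap.ker ρ ⊓ I ^ (j + 1) • ⊤ := by
  have hle : I • (Q.comap (ν ∘ₗ ρ) ⊓ I ^ j • ⊤) ≤ I ^ (j + 1) • ⊤ := by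
    rw [pow_succ', mul_smul]
    exact smul_mono_right _ inf_le_right
  have hmap : (Q.comap (ν ∘ₗ ρ) ⊓ I ^ j • ⊤).map ρ = Q.comap ν ⊓ I ^ (n + j) • ⊤ := by
    rw [Submodule.comap_comp, inf_comm, ← Submodule.map_inf_eq_map_inf_comap,
      map_pow_smul_top_of_range_eq hρ, inf_comm]
  rw [← sup_inf_assoc_of_le _ hle, ← Submodule.comap_map_eq, Submodule.map_smul'', hmap]
  refine le_inf (le_trans ?_ (Submodule.comap_mono hν)) inf_le_right
  rw [Submodule.comap_inf, comap_pow_smul_top_of_range_eq hρ, LinearMap.ker_comp]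
  exact inf_le_inf_left _ le_sup_left

/-- An element of `I ^ (j + 2) F` is `∑ i, x i • c i` with `c i` in `I ^ (j + 1) F`. If it is killed
by `π`, then `i ↦ π (c i)` is a relation between the `x i` in `N`, and by `hAR` such relations come,
up to higher order, from relations of lower degree. -/
theorem ker_inf_pow_smul_top_le {ι : Type*} [Fintype ι] {x : ι → A}
    (hx : Ideal.span (Set.range x) = I) {π : F →ₗ[A] N} {n j : ℕ}
    (hπ : LinearMap.range π = I ^ n • ⊤)
    (hAR : LinearMap.ker (weightedSum x N) ⊓ I ^ (n + (j + 1)) • ⊤ ≤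
      I • ((I ^ (n + (j + 2)) • ⊤ : Submodule A N).comap (weightedSum x N) ⊓ I ^ (n + j) • ⊤)) :
    LinearMap.ker π ⊓ I ^ (j + 2) • ⊤ ≤
      I • (LinearMap.ker π ⊓ I ^ (j + 1) • ⊤) ⊔ LinearMap.ker π ⊓ I ^ (j + 3) • ⊤ := by
  set ρ := π.compLeft ι
  set μ := weightedSum x F
  have hρ : LinearMap.range ρ = I ^ n • ⊤ := by
    rw [LinearMap.range_compLeft, hπ, smul_top_eq_pi]
  have hμρ : weightedSum x N ∘ₗ ρ = π ∘ₗ μ := weightedSum_comp_compLeft x π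
  have map_μ (k : ℕ) : (I ^ k • (⊤ : Submodule A (ι → F))).map μ = I ^ (k + 1) • ⊤ := by
    rw [smul_top_eq_pi, map_weightedSum_pi, hx, pow_succ', mul_smul]
  set Y : Submodule A (ι → F) :=
    (I ^ (n + (j + 2)) • ⊤ : Submodule A N).comap (π ∘ₗ μ) ⊓ I ^ j • ⊤
  have hY : LinearMap.ker (π ∘ₗ μ) ⊓ I ^ (j + 1) • ⊤ ≤
      I • Y ⊔ LinearMap.ker ρ ⊓ I ^ (j + 1) • ⊤ := by
    simpa only [hμρ] using ker_comp_inf_pow_smul_top_le hρ _ hAR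
  have hμY : Y.map μ ≤ I ^ (j + 2) • ⊤ ⊔ LinearMap.ker π ⊓ I ^ (j + 1) • ⊤ := by
    rw [← sup_inf_assoc_of_le _ (Submodule.pow_smul_top_le I F (Nat.le_succ _)),
      ← comap_pow_smul_top_of_range_eq hπ, ← map_μ, inf_comm, Submodule.map_inf_eq_map_inf_comap,
      inf_comm]
    rfl
  have hkerρ : (LinearMap.ker ρ ⊓ I ^ (j + 1) • ⊤).map μ ≤
      I • (LinearMap.ker π ⊓ I ^ (j + 1) • ⊤) := by
    rw [smul_top_eq_pi, LinearMap.ker_compLeft, ← hx, ← map_weightedSum_pi]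
    exact Submodule.map_mono fun t ht i hi => ⟨ht.1 i hi, ht.2 i hi⟩
  have hle : LinearMap.ker π ⊓ I ^ (j + 2) • ⊤ ≤
      I • (LinearMap.ker π ⊓ I ^ (j + 1) • ⊤) ⊔ I ^ (j + 3) • ⊤ :=
    calc LinearMap.ker π ⊓ I ^ (j + 2) • ⊤
      _ = (LinearMap.ker (π ∘ₗ μ) ⊓ I ^ (j + 1) • ⊤).map μ := by
        rw [inf_comm, ← map_μ, Submodule.map_inf_eq_map_inf_comap, inf_comm, LinearMap.ker_comp]
      _ ≤ I • Y.map μ ⊔ (LinearMap.ker ρ ⊓ I ^ (j + 1) • ⊤).map μ := by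
        rw [← Submodule.map_smul'', ← Submodule.map_sup]
        exact Submodule.map_mono hY
      _ ≤ I • (I ^ (j + 2) • ⊤ ⊔ LinearMap.ker π ⊓ I ^ (j + 1) • ⊤) ⊔
          I • (LinearMap.ker π ⊓ I ^ (j + 1) • ⊤) :=
        sup_le_sup (smul_mono_right _ hμY) hkerρ
      _ = I • (LinearMap.ker π ⊓ I ^ (j + 1) • ⊤) ⊔ I ^ (j + 3) • ⊤ := by
        rw [Submodule.smul_sup, ← mul_smul, ← pow_succ', sup_assoc, sup_idem, sup_comm]
  rw [inf_comm _ (I ^ (j + 3) • ⊤),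
    ← sup_inf_assoc_of_le _ (Submodule.smul_le_right.trans inf_le_left)]
  exact le_inf hle inf_le_left

end LinearPresentation

variable [IsNoetherianRing A]

variable (I) in
theorem exists_forall_isLinearRelations_ker (N : Type*) [AddCommGroup N] [Module A N]
    [Module.Finite A N] :
    ∃ n₀, ∀ n ≥ n₀, ∀ (F : Type v) [AddCommGroup F] [Module A F] [Module.Finite A F]
      (π : F →ₗ[A] N), LinearMap.range π = I ^ n • ⊤ → LinearMap.ker π ≤ I • ⊤ →
        IsLinearRelations I (LinearMap.ker π) := by
  obtain ⟨e, x, hx⟩ := Submodule.fg_iff_exists_fin_generating_family.1 (IsNoetherian.noetherian I)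
  obtain ⟨n₀, hn₀⟩ := exists_forall_smul_inf_iInf_comap_eq I (fun _ : Unit => weightedSum x N) 2
  refine ⟨n₀, fun n hn F _ _ _ π hπ hker j => ?_⟩
  have hAR (j : ℕ) : LinearMap.ker (weightedSum x N) ⊓ I ^ (n + (j + 1)) • ⊤ ≤
      I • ((I ^ (n + (j + 2)) • ⊤ : Submodule A N).comap (weightedSum x N) ⊓ I ^ (n + j) • ⊤) := by
    have h := hn₀ (n + j) (by omega)
    rw [iInf_const, iInf_const] at h
    exact (inf_le_inf_right _ (LinearMap.ker_le_comap _)).trans h.ge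
  have hstable := (I.stableFiltration_stable (⊤ : Submodule A F)).inter_left
    (F' := I.trivialFiltration (LinearMap.ker π))
  have hsucc (j : ℕ) := smul_filtration_eq_of_le_sup hstable (j₀ := 1) (j := j + 1)
    (fun j hj => by
      obtain ⟨j, rfl⟩ := Nat.exists_eq_add_of_le' hj
      exact ker_inf_pow_smul_top_le hx hπ (hAR j)) (by omega)
  induction j with
  | zero => simpa using hker
  | succ j ih =>
    rw [pow_succ' I j, mul_smul, ← ih]
    exact (hsucc j).symm

end Filtration

open IsLocalRing TensorProduct in
theorem exists_surjective_ker_le_maximalIdeal_smul_top (A : Type*) [CommRing A] [IsLocalRing A]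
    (N : Type*) [AddCommGroup N] [Module A N] [Module.Finite A N] :
    ∃ (s : ℕ) (π : (Fin s → A) →ₗ[A] N), Function.Surjective π ∧
      LinearMap.ker π ≤ maximalIdeal A • ⊤ := by
  let b := Module.finBasis (ResidueField A) (ResidueField A ⊗[A] N)
  choose g hg using fun i => TensorProduct.mk_surjective A N (ResidueField A)
    IsLocalRing.residue_surjective (b i)
  refine ⟨_, Fintype.linearCombination A g, ?_, fun c hc => ?_⟩
  · rw [← LinearMap.range_eq_top, Fintype.range_linearCombination]
    exact IsLocalRing.span_eq_top_of_tmul_eq_basis g b hg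
  rw [smul_top_eq_pi]
  intro i _
  have hcomb : ∑ i, residue A (c i) • b i = 0 := by
    simpa [Fintype.linearCombination_apply, hg, ← ResidueField.algebraMap_eq] using
      congrArg (TensorProduct.mk A (ResidueField A) N 1) hc
  simpa [residue_eq_zero_iff] using Fintype.linearIndependent_iff.1 b.linearIndependent _ hcomb i

section GradedModule

variable {𝒜 ℳ : ℕ → Type*} [∀ i, AddCommMonoid (𝒜 i)] [∀ i, AddCommMonoid (ℳ i)]
  [GSemiring 𝒜] [Gmodule 𝒜 ℳ]

theorem of_smul_apply_add {i : ℕ} (a : 𝒜 i) (t : ⨁ j, ℳ j) (k : ℕ) :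
    (of 𝒜 i a • t) (i + k) = GradedMonoid.GSMul.smul a (t k) := by
  induction t using DirectSum.induction_on with
  | zero => rw [smul_zero, DirectSum.zero_apply, DirectSum.zero_apply,
      GdistribMulAction.smul_zero]
  | add t t' ht ht' =>
    rw [smul_add, DirectSum.add_apply, ht, ht', DirectSum.add_apply, GdistribMulAction.smul_add]
  | of j x =>
    rw [Gmodule.of_smul_of]
    obtain rfl | hjk := eq_or_ne j k
    · rw [of_eq_same]
      exact of_eq_same _ _
    · rw [of_eq_of_ne _ _ _ hjk.symm, GdistribMulAction.smul_zero]
      exact of_eq_of_ne _ _ _ (by simpa using hjk.symm)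

theorem of_smul_apply_of_lt {i l : ℕ} (hl : l < i) (a : 𝒜 i) (t : ⨁ j, ℳ j) :
    (of 𝒜 i a • t) l = 0 := by
  induction t using DirectSum.induction_on with
  | zero => simp
  | add t t' ht ht' => rw [smul_add, DirectSum.add_apply, ht, ht', add_zero]
  | of j x =>
    rw [Gmodule.of_smul_of]
    exact of_eq_of_ne _ _ _ (by simp only [vadd_eq_add]; omega)

theorem of_smul_apply_eq_zero {i n l : ℕ} (a : 𝒜 i) {t : ⨁ j, ℳ j} (ht : ∀ j < n, t j = 0)
    (hl : l < i + n) : (of 𝒜 i a • t) l = 0 := by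
  obtain hli | hil := lt_or_ge l i
  · exact of_smul_apply_of_lt hli a t
  · obtain ⟨k, rfl⟩ := Nat.exists_eq_add_of_le hil
    rw [of_smul_apply_add, ht k (by omega), GdistribMulAction.smul_zero]

/-- The linear map on a graded module given by compatible additive maps on the components. -/
def gradedLift {N : Type*} [AddCommMonoid N] [Module (⨁ i, 𝒜 i) N] (φ : ∀ j, ℳ j →+ N)
    (hφ : ∀ {i j} (a : 𝒜 i) (x : ℳ j), φ (i + j) (GradedMonoid.GSMul.smul a x) =
      of 𝒜 i a • φ j x) : (⨁ j, ℳ j) →ₗ[⨁ i, 𝒜 i] N where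
  __ := toAddMonoid φ
  map_smul' r t := by
    change toAddMonoid φ (r • t) = r • toAddMonoid φ t
    induction r using DirectSum.induction_on with
    | zero => rw [zero_smul, zero_smul, map_zero]
    | add r r' hr hr' => rw [add_smul, map_add, hr, hr', add_smul]
    | of i a =>
      induction t using DirectSum.induction_on with
      | zero => rw [smul_zero, map_zero, smul_zero]
      | add t t' ht ht' => rw [smul_add, map_add, ht, ht', map_add, smul_add]
      | of j x =>
        rw [Gmodule.of_smul_of, toAddMonoid_of, toAddMonoid_of]
        exact hφ a x

variable (𝒜 ℳ) in
/-- The submodule of a graded module generated by the components of degree at least `n`. -/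
def degreeGE (n : ℕ) : Submodule (⨁ i, 𝒜 i) (⨁ i, ℳ i) where
  carrier := {t | ∀ l < n, t l = 0}
  add_mem' ht ht' l hl := by rw [DirectSum.add_apply, ht l hl, ht' l hl, add_zero]
  zero_mem' _ _ := rfl
  smul_mem' r t ht l hl := by
    induction r using DirectSum.induction_on with
    | zero => simp
    | of i a => exact of_smul_apply_eq_zero a ht (by omega)
    | add r r' hr hr' => rw [add_smul, DirectSum.add_apply, hr, hr', add_zero]

theorem eq_zero_of_forall_smul_eq_zero_of_notMem {𝒜 ℳ : ℕ → Type*}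
    [∀ i, AddCommGroup (𝒜 i)] [∀ i, AddCommMonoid (ℳ i)] [GCommRing 𝒜] [Gmodule 𝒜 ℳ]
    {p : Ideal (⨁ i, 𝒜 i)} [hp : p.IsMaximal] {i : ℕ}
    (hi : 0 < i) {a : 𝒜 i} (ha : of 𝒜 i a ∉ p) {t : ⨁ j, ℳ j} (ht : ∀ r ∈ p, r • t = 0) :
    t = 0 := by
  obtain ⟨y, b, hb, hyb⟩ := hp.exists_inv ha
  have hts : t = of 𝒜 i a • y • t := by
    rw [smul_smul, mul_comm, ← add_zero (_ • t), ← ht b hb, ← add_smul, hyb, one_smul]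
  have hmem (n : ℕ) : t ∈ degreeGE 𝒜 ℳ n := by
    induction n with
    | zero => exact fun l hl => absurd hl l.not_lt_zero
    | succ n ih =>
      intro l hl
      rw [hts]
      exact of_smul_apply_eq_zero a ((degreeGE 𝒜 ℳ n).smul_mem y ih) (by omega)
  exact DFinsupp.ext fun n => hmem (n + 1) n n.lt_succ_self

end GradedModule

namespace AssocGraded

variable {A : Type u} [CommRing A]

/-- The direct sum underlying `AssocGradedRing I` and `AssocGradedModule I M`, kept reducible so
that the library on internally graded direct sums applies. -/
abbrev Gr (I : Ideal A) (M : Type v) [AddCommGroup M] [Module A M] : Type v :=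
  ⨁ n, Piece I M n

variable {I : Ideal A} {M : Type v} [AddCommGroup M] [Module A M]

theorem mem_powSMul_zero (x : M) : x ∈ powSMul I M 0 := by
  rw [powSMul, pow_zero, Ideal.one_eq_top, Submodule.top_smul]
  exact Submodule.mem_top

theorem mk_eq_zero_iff {n : ℕ} {x : M} {hx : x ∈ powSMul I M n} :
    mk I n x hx = 0 ↔ x ∈ powSMul I M (n + 1) :=
  Submodule.Quotient.mk_eq_zero _

theorem mk_sum {n : ℕ} {κ : Type*} (s : Finset κ) {x : κ → M} (hx : ∀ k, x k ∈ powSMul I M n) :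
    ∑ k ∈ s, mk I n (x k) (hx k) = mk I n (∑ k ∈ s, x k) (sum_mem fun k _ => hx k) := by
  simp only [mk, ← Submodule.mkQ_apply, ← map_sum]
  congr
  exact Subtype.ext (AddSubmonoidClass.coe_finsetSum ..)

theorem of_mk_smul_of_mk {i j : ℕ} {a : A} {x : M} (ha : a ∈ powSMul I A i)
    (hx : x ∈ powSMul I M j) :
    of (Piece I A) i (mk I i a ha) • of (Piece I M) j (mk I j x hx) =
      of (Piece I M) (i + j) (mk I (i + j) (a • x) (smul_mem_powSMul ha hx)) :=
  Gmodule.of_smul_of ..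

theorem eq_zero_of_forall_mem_smul_eq_zero
    (hM : ∀ n, ∀ u ∈ powSMul I M n, (∀ a ∈ I, a • u ∈ powSMul I M (n + 2)) →
      u ∈ powSMul I M (n + 1))
    {p : Ideal (Gr I A)} (hp : p.IsMaximal) {t : Gr I M} (ht : ∀ r ∈ p, r • t = 0) : t = 0 := by
  by_cases h : ∃ a, of (Piece I A) 1 a ∉ p
  · obtain ⟨a, ha⟩ := h
    exact eq_zero_of_forall_smul_eq_zero_of_notMem one_pos ha ht
  push Not at h
  refine DFinsupp.ext fun n => ?_
  obtain ⟨u, hu, hut⟩ := exists_mk (t n)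
  refine hut.trans (mk_eq_zero_iff.2 (hM n u hu fun a ha => ?_))
  have ha' : a ∈ powSMul I A 1 := by simpa using ha
  have hau : pieceSMul I M 1 n (mk I 1 a ha') (t n) = 0 := by
    exact (of_smul_apply_add (mk I 1 a ha') t n).symm.trans
      (congrArg (fun s : Gr I M => s (1 + n)) (ht _ (h (mk I 1 a ha'))))
  rw [hut, pieceSMul_mk, mk_eq_zero_iff] at hau
  rwa [show n + 2 = 1 + n + 1 by omega]

theorem notMem_associatedPrimes_of_isMaximal [IsNoetherianRing (AssocGradedRing I)]
    (hM : ∀ n, ∀ u ∈ powSMul I M n, (∀ a ∈ I, a • u ∈ powSMul I M (n + 2)) →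
      u ∈ powSMul I M (n + 1))
    (p : Ideal (AssocGradedRing I)) [p.IsMaximal] :
    p ∉ associatedPrimes (AssocGradedRing I) (AssocGradedModule I M) := by
  intro hp
  obtain ⟨t, ht, hpt⟩ := mem_associatedPrimes_iff_exists_ne_zero.1 hp
  exact ht (eq_zero_of_forall_mem_smul_eq_zero hM ‹_› hpt)

section Map

variable {N : Type*} [AddCommGroup N] [Module A N]

/-- The map `I ^ n M / I ^ (n + 1) M → I ^ (n + c) N / I ^ (n + c + 1) N` induced by a linear map
that raises the order by `c`. -/
def pieceMap (f : M →ₗ[A] N) {c : ℕ} (hf : ∀ n, powSMul I M n ≤ (powSMul I N (n + c)).comap f)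
    (n : ℕ) : Piece I M n →ₗ[A] Piece I N (n + c) :=
  Submodule.mapQ _ _ (f.restrict (hf n)) fun x hx => by
    have := hf (n + 1) hx
    rwa [add_right_comm] at this

theorem pieceMap_mk {f : M →ₗ[A] N} {c : ℕ}
    (hf : ∀ n, powSMul I M n ≤ (powSMul I N (n + c)).comap f) {n : ℕ} {x : M}
    (hx : x ∈ powSMul I M n) :
    pieceMap f hf n (mk I n x hx) = mk I (n + c) (f x) (hf n hx) :=
  rfl

/-- The map of associated graded modules of degree `c` induced by a linear map that raises the
order by `c`. -/
def map (f : M →ₗ[A] N) (c : ℕ) (hf : ∀ n, powSMul I M n ≤ (powSMul I N (n + c)).comap f) :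
    Gr I M →ₗ[Gr I A] Gr I N :=
  gradedLift (fun n => (of (Piece I N) (n + c)).comp (pieceMap f hf n).toAddMonoidHom) <| by
    intro i j a x
    obtain ⟨a, ha, rfl⟩ := exists_mk a
    obtain ⟨x, hx, rfl⟩ := exists_mk x
    refine .trans ?_ (of_mk_smul_of_mk ha (hf j hx)).symm
    exact of_eq_of_gradedMonoid_eq (gradedMk_eq (add_assoc i j c) (map_smul f a x) _ _)

variable {f : M →ₗ[A] N} {c : ℕ} (hf : ∀ n, powSMul I M n ≤ (powSMul I N (n + c)).comap f)

theorem map_of_mk {n : ℕ} {x : M} (hx : x ∈ powSMul I M n) :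
    map f c hf (of (Piece I M) n (mk I n x hx)) =
      of (Piece I N) (n + c) (mk I (n + c) (f x) (hf n hx)) :=
  toAddMonoid_of ..

theorem map_apply_add (t : Gr I M) (n : ℕ) : map f c hf t (n + c) = pieceMap f hf n (t n) := by
  induction t using DirectSum.induction_on with
  | zero => simp only [map_zero, DirectSum.zero_apply]
  | add t t' ht ht' => rw [map_add, DirectSum.add_apply, ht, ht', DirectSum.add_apply, map_add]
  | of j x =>
    obtain ⟨x, hx, rfl⟩ := exists_mk x
    rw [map_of_mk]
    obtain rfl | hjn := eq_or_ne j n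
    · rw [of_eq_same, of_eq_same, pieceMap_mk]
    · rw [of_eq_of_ne _ _ _ hjn.symm, of_eq_of_ne _ _ _ (by simpa using hjn.symm), map_zero]

theorem map_injective (hf' : ∀ n, (powSMul I N (n + c)).comap f ≤ powSMul I M n) :
    Function.Injective (map f c hf) := by
  rw [injective_iff_map_eq_zero]
  refine fun t ht => DFinsupp.ext fun n => ?_
  obtain ⟨x, hx, hxt⟩ := exists_mk (t n)
  have hfx : pieceMap f hf n (t n) = 0 := by rw [← map_apply_add, ht, DirectSum.zero_apply]
  rw [hxt, pieceMap_mk, mk_eq_zero_iff, add_right_comm] at hfx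
  exact hxt.trans (mk_eq_zero_iff.2 (hf' (n + 1) hfx))

theorem powSMul_le_comap (f : M →ₗ[A] N) (n : ℕ) :
    powSMul I M n ≤ (powSMul I N (n + 0)).comap f :=
  Submodule.smul_top_le_comap_smul_top _ f

end Map

section Free

variable (I) (ι : Type*) [Finite ι]

theorem exists_leftInverse_pi : ∃ (s : Gr I (ι → A) →ₗ[Gr I A] ι → Gr I A)
    (r : (ι → Gr I A) →ₗ[Gr I A] Gr I (ι → A)), r ∘ₗ s = LinearMap.id := by
  classical
  cases nonempty_fintype ι
  refine ⟨LinearMap.pi fun i => map (LinearMap.proj i) 0 (powSMul_le_comap _),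
    ∑ i, map (LinearMap.single A (fun _ => A) i) 0 (powSMul_le_comap _) ∘ₗ LinearMap.proj i,
    LinearMap.ext fun t => ?_⟩
  induction t using DirectSum.induction_on with
  | zero => simp only [map_zero]
  | add t t' ht ht' => rw [map_add, ht, ht', map_add]
  | of n x =>
    obtain ⟨x, hx, rfl⟩ := exists_mk x
    have hx' (i : ι) : Pi.single i (x i) ∈ powSMul I (ι → A) n :=
      powSMul_le_comap
        (LinearMap.single A (fun _ => A) i ∘ₗ LinearMap.proj (φ := fun _ => A) i) n hx
    have hsr (i : ι) : map (LinearMap.single A (fun _ => A) i) 0 (powSMul_le_comap _)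
        (map (LinearMap.proj i) 0 (powSMul_le_comap _) (of (Piece I (ι → A)) n (mk I n x hx))) =
          of (Piece I (ι → A)) n (mk I n (Pi.single i (x i)) (hx' i)) := by
      rw [map_of_mk, map_of_mk]
      rfl
    rw [LinearMap.comp_apply, LinearMap.sum_apply]
    refine (Finset.sum_congr rfl fun i _ => hsr i).trans ?_
    simp only [← map_sum, mk_sum, Finset.univ_sum_single, LinearMap.id_apply]

instance finite_pi : Module.Finite (AssocGradedRing I) (AssocGradedModule I (ι → A)) := by
  obtain ⟨s, r, hrs⟩ := exists_leftInverse_pi I ι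
  have : Module.Finite (Gr I A) (Gr I A) := Module.Finite.self _
  exact Module.Finite.of_surjective r (LinearMap.surjective_of_comp_eq_id s r hrs)

instance flat_pi : Module.Flat (AssocGradedRing I) (AssocGradedModule I (ι → A)) := by
  obtain ⟨s, r, hrs⟩ := exists_leftInverse_pi I ι
  have : Module.Flat (Gr I A) (Gr I A) := Module.Flat.self
  have : Module.Flat (Gr I A) (Gr I (ι → A)) := Module.Flat.of_retract s r hrs
  exact this

end Free

section Syzygy

variable {N : Type*} [AddCommGroup N] [Module A N] {π : M →ₗ[A] N}

theorem mem_powSMul_ker_iff (hK : IsLinearRelations I (LinearMap.ker π)) {n : ℕ}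
    {x : LinearMap.ker π} : x ∈ powSMul I (LinearMap.ker π) n ↔ (x : M) ∈ powSMul I M (n + 1) := by
  rw [powSMul, Submodule.mem_smul_top_iff, ← hK n, Submodule.mem_inf, and_iff_right x.2]

theorem powSMul_ker_le_comap (hK : IsLinearRelations I (LinearMap.ker π)) (n : ℕ) :
    powSMul I (LinearMap.ker π) n ≤ (powSMul I M (n + 1)).comap (LinearMap.ker π).subtype :=
  fun _ => (mem_powSMul_ker_iff hK).1

theorem map_ker_subtype_injective (hK : IsLinearRelations I (LinearMap.ker π)) :
    Function.Injective (map (LinearMap.ker π).subtype 1 (powSMul_ker_le_comap hK)) :=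
  map_injective _ fun _ _ => (mem_powSMul_ker_iff hK).2

theorem map_map_ker_subtype (hK : IsLinearRelations I (LinearMap.ker π))
    (t : Gr I (LinearMap.ker π)) :
    map π 0 (powSMul_le_comap π)
      (map (LinearMap.ker π).subtype 1 (powSMul_ker_le_comap hK) t) = 0 := by
  induction t using DirectSum.induction_on with
  | zero => simp only [map_zero]
  | add t t' ht ht' => rw [map_add, map_add, ht, ht', add_zero]
  | of n x =>
    obtain ⟨x, hx, rfl⟩ := exists_mk x
    rw [map_of_mk, map_of_mk, mk_eq_zero_iff.2, map_zero]
    rw [Submodule.subtype_apply, LinearMap.mem_ker.1 x.2]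
    exact zero_mem _

theorem exists_sub_mem_powSMul_of_apply_mem (hπ : Function.Surjective π) {n : ℕ} {u : M}
    (hu : π u ∈ powSMul I N n) : ∃ v ∈ LinearMap.ker π, u - v ∈ powSMul I M n := by
  have hmap : (powSMul I M n).map π = powSMul I N n := by
    rw [Submodule.map_smul'', Submodule.map_top, LinearMap.range_eq_top.2 hπ]
  obtain ⟨b, hb, hbu⟩ := hmap.ge hu
  exact ⟨u - b, by rw [LinearMap.mem_ker, map_sub, hbu, sub_self], by rwa [sub_sub_cancel]⟩

theorem exact_map_ker_subtype (hπ : Function.Surjective π)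
    (hK : IsLinearRelations I (LinearMap.ker π)) :
    Function.Exact (map (LinearMap.ker π).subtype 1 (powSMul_ker_le_comap hK))
      (map π 0 (powSMul_le_comap (I := I) π)) := by
  classical
  refine fun t => ⟨fun ht => ?_, ?_⟩
  · rw [← sum_support_of t, ← LinearMap.coe_range, SetLike.mem_coe]
    refine sum_mem fun n _ => ?_
    obtain ⟨u, hu, hut⟩ := exists_mk (t n)
    have hπu : pieceMap π (powSMul_le_comap π) n (t n) = 0 := by
      rw [← map_apply_add, ht, DirectSum.zero_apply]
    rw [hut, pieceMap_mk, mk_eq_zero_iff] at hπu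
    obtain ⟨v, hv, huv⟩ := exists_sub_mem_powSMul_of_apply_mem hπ hπu
    have hvn : v ∈ powSMul I M n := by
      simpa using sub_mem hu (Submodule.pow_smul_top_le I M n.le_succ huv)
    have htv : t n = mk I n v hvn := hut.trans ((Submodule.Quotient.eq _).2 huv)
    rw [htv]
    cases n with
    | zero =>
      have hv1 : v ∈ powSMul I M 1 := (mem_powSMul_ker_iff hK (x := ⟨v, hv⟩)).1 (mem_powSMul_zero _)
      rw [mk_eq_zero_iff.2 hv1, map_zero]
      exact zero_mem _
    | succ n => exact ⟨_, map_of_mk _ ((mem_powSMul_ker_iff hK (x := ⟨v, hv⟩)).2 hvn)⟩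
  · rintro ⟨t, rfl⟩
    exact map_map_ker_subtype hK t

theorem isCohenMacaulay_ker [IsNoetherianRing (AssocGradedRing I)]
    (hG : IsCohenMacaulay (AssocGradedRing I) (AssocGradedRing I))
    (hdim : ringKrullDim (AssocGradedRing I) ≤ 2) {ι : Type*} [Finite ι] {π : (ι → A) →ₗ[A] N}
    (hπ : Function.Surjective π) (hK : IsLinearRelations I (LinearMap.ker π))
    (hN : ∀ n, ∀ u ∈ powSMul I N n, (∀ a ∈ I, a • u ∈ powSMul I N (n + 2)) →
      u ∈ powSMul I N (n + 1)) :
    IsCohenMacaulay (AssocGradedRing I) (AssocGradedModule I (LinearMap.ker π)) :=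
  hG.of_syzygy (F := AssocGradedModule I (ι → A)) (T := AssocGradedModule I N) hdim
    (map_ker_subtype_injective hK) (exact_map_ker_subtype hπ hK)
    fun p _ => notMem_associatedPrimes_of_isMaximal hN p

end Syzygy

end AssocGraded

namespace AssocGraded

variable {A : Type u} [CommRing A] {I : Ideal A}

instance : DirectSum.GAlgebra A (Piece I A) where
  toFun := AddMonoidHom.mk' (fun a => mk I 0 a (mem_powSMul_zero a)) fun _ _ => rfl
  map_one := rfl
  map_mul a b := gradedMk_eq rfl rfl _ _
  commutes a := by
    rintro ⟨i, b⟩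
    obtain ⟨b, hb, rfl⟩ := exists_mk b
    exact gradedMk_eq (add_comm 0 i) (mul_comm a b) _ _
  smul_def a := by
    rintro ⟨i, b⟩
    obtain ⟨b, hb, rfl⟩ := exists_mk b
    exact gradedMk_eq (zero_add i).symm rfl (Submodule.smul_mem _ a hb) _

instance : Algebra A (AssocGradedRing I) :=
  inferInstanceAs (Algebra A (⨁ n, Piece I A n))

theorem adjoin_range_of_one : Algebra.adjoin A (Set.range (of (Piece I A) 1)) = ⊤ := by
  set S := Algebra.adjoin A (Set.range (of (Piece I A) 1))
  have hmem (n : ℕ) : ∀ a ha, of (Piece I A) n (mk I n a ha) ∈ S := by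
    induction n with
    | zero => exact fun a _ => S.algebraMap_mem a
    | succ n ih =>
      intro a ha
      have ha' : a ∈ I ^ n * I := by simpa [pow_succ] using ha
      obtain ⟨_, h⟩ : ∃ ha, of (Piece I A) (n + 1) (mk I (n + 1) a ha) ∈ S := by
        induction ha' using Submodule.mul_induction_on' with
        | mem_mul_mem b hb c hc =>
          have hb' : b ∈ powSMul I A n := by simpa using hb
          have hc' : c ∈ powSMul I A 1 := by simpa using hc
          refine ⟨smul_mem_powSMul hb' hc', ?_⟩
          have := mul_mem (ih b hb') (Algebra.subset_adjoin (Set.mem_range_self (mk I 1 c hc')))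
          rwa [of_mul_of] at this
        | add b _ c _ hb hc =>
          obtain ⟨hb', hb⟩ := hb (by simpa [pow_succ])
          obtain ⟨hc', hc⟩ := hc (by simpa [pow_succ])
          refine ⟨add_mem hb' hc', ?_⟩
          have := add_mem hb hc
          rwa [← map_add] at this
      exact h
  refine eq_top_iff.2 fun r _ => ?_
  induction r using DirectSum.induction_on with
  | zero => exact zero_mem S
  | add r r' hr hr' => exact add_mem (hr trivial) (hr' trivial)
  | of n a =>
    obtain ⟨a, ha, rfl⟩ := exists_mk a
    exact hmem n a ha

instance [IsNoetherianRing A] : Algebra.FiniteType A (AssocGradedRing I) := by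
  obtain ⟨s, hs⟩ := Module.Finite.fg_top (R := A) (M := Piece I A 1)
  have hspan : Submodule.span A (lof A ℕ (Piece I A) 1 '' s) =
      Set.range (of (Piece I A) 1) := by
    rw [Submodule.span_image, hs, Submodule.map_top]
    rfl
  have hadjoin : Algebra.adjoin A (lof A ℕ (Piece I A) 1 '' s) = ⊤ := by
    rw [← Algebra.adjoin_span, hspan, adjoin_range_of_one]
  exact ⟨Subalgebra.fg_def.2 ⟨_, s.finite_toSet.image _, hadjoin⟩⟩

instance [IsNoetherianRing A] : IsNoetherianRing (AssocGradedRing I) :=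
  Algebra.FiniteType.isNoetherianRing A _

instance : Algebra (A ⧸ I) (AssocGradedRing I) :=
  (Ideal.Quotient.lift I (algebraMap A (AssocGradedRing I)) fun a ha => by
    have h : mk I 0 a (mem_powSMul_zero a) = 0 := mk_eq_zero_iff.2 (by simpa using ha)
    exact (congrArg (of (Piece I A) 0) h).trans (map_zero _)).toAlgebra

instance : IsScalarTower A (A ⧸ I) (AssocGradedRing I) :=
  .of_algebraMap_eq fun _ => rfl

instance [IsNoetherianRing A] : Algebra.FiniteType (A ⧸ I) (AssocGradedRing I) :=
  .of_restrictScalars_finiteType A (A ⧸ I) (AssocGradedRing I)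

end AssocGraded

section GradedRing

variable {𝒜 : ℕ → Type*} [∀ i, AddCommMonoid (𝒜 i)]

variable (𝒜) in
/-- The filtration of a direct sum by the sums of the components of degree at most `n`. -/
def degreeLE (n : ℕ) : AddSubmonoid (⨁ i, 𝒜 i) where
  carrier := {r | ∀ l > n, r l = 0}
  add_mem' hr hr' l hl := by rw [DirectSum.add_apply, hr l hl, hr' l hl, add_zero]
  zero_mem' _ _ := rfl

theorem degreeLE_mono : Monotone (degreeLE 𝒜) :=
  fun _ _ hmn _ hr l hl => hr l (hmn.trans_lt hl)

theorem exists_mem_degreeLE (r : ⨁ i, 𝒜 i) : ∃ n, r ∈ degreeLE 𝒜 n := by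
  classical
  refine ⟨(DFinsupp.support r).sup id, fun l hl => ?_⟩
  by_contra h
  exact hl.not_ge (Finset.le_sup (f := id) (DFinsupp.mem_support_iff.2 h))

theorem of_mem_degreeLE {i n : ℕ} (hi : i ≤ n) (a : 𝒜 i) : of 𝒜 i a ∈ degreeLE 𝒜 n :=
  fun _ hl => of_eq_of_ne _ _ _ (hi.trans_lt hl).ne'

instance [GSemiring 𝒜] : SetLike.GradedMonoid (degreeLE 𝒜) where
  one_mem := of_mem_degreeLE le_rfl _
  mul_mem m n r r' hr hr' := by
    classical
    rw [mul_eq_sum_support_ghas_mul]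
    refine sum_mem fun ij hij => of_mem_degreeLE ?_ _
    obtain ⟨hi, hj⟩ := Finset.mem_product.1 hij
    refine add_le_add (not_lt.1 fun h => ?_) (not_lt.1 fun h => ?_)
    exacts [DFinsupp.mem_support_iff.1 hi (hr _ h), DFinsupp.mem_support_iff.1 hj (hr' _ h)]

end GradedRing

section Growth

theorem le_of_forall_pow_le {t d D L : ℕ} (h : ∀ N, N ^ t ≤ (N * D + 1) ^ d * L) : t ≤ d := by
  by_contra! hdt
  set C := (D + 1) ^ d * L
  have hC : (C + 1) ^ (d + 1) ≤ (C + 1) ^ d * C := calc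
    (C + 1) ^ (d + 1) ≤ (C + 1) ^ t := Nat.pow_le_pow_right C.succ_pos hdt
    _ ≤ ((C + 1) * D + 1) ^ d * L := h (C + 1)
    _ ≤ ((C + 1) * (D + 1)) ^ d * L := by gcongr; rw [mul_add_one]; omega
    _ = (C + 1) ^ d * C := by rw [mul_pow, mul_assoc]
  rw [pow_succ] at hC
  exact absurd (le_of_mul_le_mul_left hC (by positivity)) C.lt_succ_self.not_ge

theorem le_of_forall_card_le_of_injective {k B : Type*} [Field k] [CommRing B] [Algebra k B]
    (F : ℕ → AddSubmonoid B) [SetLike.GradedMonoid F] (hmono : Monotone F)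
    (hF : ∀ b, ∃ n, b ∈ F n) {d L : ℕ}
    (hcard : ∀ (κ : Type) [Fintype κ] (v : κ → B) (n : ℕ), LinearIndependent k v →
      (∀ i, v i ∈ F n) → Fintype.card κ ≤ (n + 1) ^ d * L)
    {t : ℕ} {φ : MvPolynomial (Fin t) k →ₐ[k] B} (hφ : Function.Injective φ) : t ≤ d := by
  choose D hD using fun i => hF (φ (MvPolynomial.X i))
  refine le_of_forall_pow_le (D := ∑ i, D i) (L := L) fun N => ?_
  let exponent (e : Fin t → Fin N) : Fin t →₀ ℕ := Finsupp.equivFunOnFinite.symm fun i => e i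
  have hexponent : Function.Injective exponent := fun e e' h =>
    funext fun i => Fin.ext (congrFun (Finsupp.equivFunOnFinite.symm.injective h) i)
  have hv : LinearIndependent k fun e => φ (MvPolynomial.basisMonomials (Fin t) k (exponent e)) :=
    ((MvPolynomial.basisMonomials (Fin t) k).linearIndependent.comp exponent hexponent).map'
      φ.toLinearMap (LinearMap.ker_eq_bot.2 hφ)
  have hmem (e : Fin t → Fin N) :
      φ (MvPolynomial.basisMonomials (Fin t) k (exponent e)) ∈ F (N * ∑ i, D i) := by
    simp only [MvPolynomial.coe_basisMonomials, MvPolynomial.monomial_eq, map_one, one_mul,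
      Finsupp.prod_fintype _ _ fun _ => pow_zero _, map_prod, map_pow]
    refine hmono ?_ (SetLike.prod_pow_mem_graded F D _ (exponent e) fun i _ => hD i)
    rw [Finset.mul_sum]
    exact Finset.sum_le_sum fun i _ => Nat.mul_le_mul_right _ (e i).2.le
  simpa using hcard _ _ _ hv hmem

theorem ringKrullDim_le_of_isIntegral {R S : Type*} [CommRing R] [CommRing S] [Algebra R S]
    [Algebra.IsIntegral R S] : ringKrullDim S ≤ ringKrullDim R :=
  Order.krullDim_le_of_strictMono (PrimeSpectrum.comap (algebraMap R S)) fun _ _ =>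
    Ideal.IsIntegral.comap_lt_comap

theorem ringKrullDim_le_of_forall_card_le {k B : Type*} [Field k] [CommRing B]
    [Algebra k B] [Algebra.FiniteType k B] (F : ℕ → AddSubmonoid B) [SetLike.GradedMonoid F]
    (hmono : Monotone F) (hF : ∀ b, ∃ n, b ∈ F n) {d L : ℕ}
    (hcard : ∀ (κ : Type) [Fintype κ] (v : κ → B) (n : ℕ), LinearIndependent k v →
      (∀ i, v i ∈ F n) → Fintype.card κ ≤ (n + 1) ^ d * L) :
    ringKrullDim B ≤ d := by
  cases subsingleton_or_nontrivial B
  · simp [ringKrullDim_eq_bot_of_subsingleton]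
  obtain ⟨t, φ, hφ, hint⟩ := exists_integral_inj_algHom_of_fg k B
  algebraize [φ.toRingHom]
  calc
    ringKrullDim B ≤ ringKrullDim (MvPolynomial (Fin t) k) := ringKrullDim_le_of_isIntegral
    _ = t := by
      rw [MvPolynomial.ringKrullDim_of_isNoetherianRing, ringKrullDim_eq_zero_of_field, zero_add,
        Nat.card_fin]
    _ ≤ d := by exact_mod_cast le_of_forall_card_le_of_injective F hmono hF hcard hφ

end Growth

section Length

variable {A : Type*} [CommRing A]

theorem length_quotient_eq_add_of_le {X : Type*} [AddCommGroup X] [Module A X]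
    {K P : Submodule A X} (h : K ≤ P) :
    Module.length A (X ⧸ K) =
      Module.length A (P ⧸ K.comap P.subtype) + Module.length A (X ⧸ P) := by
  refine Module.length_eq_add_of_exact (Submodule.mapQ _ K P.subtype le_rfl)
    (Submodule.factor h) ?_ (Submodule.factor_surjective h) ?_
  · rw [← LinearMap.ker_eq_bot, Submodule.ker_mapQ, Submodule.mkQ_map_self]
  · rw [LinearMap.exact_iff, Submodule.factor, Submodule.ker_mapQ, Submodule.range_mapQ,
      Submodule.comap_id, Submodule.range_subtype]

theorem length_quotient_sup_span_pow_le (J : Ideal A) (a : A) (n : ℕ) :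
    Module.length A (A ⧸ J ⊔ Ideal.span {a ^ n}) ≤
      n * Module.length A (A ⧸ J ⊔ Ideal.span {a}) := by
  induction n with
  | zero => simp [Module.length_eq_zero]
  | succ n ih =>
    have hle : J ⊔ Ideal.span {a ^ (n + 1)} ≤ J ⊔ Ideal.span {a ^ n} :=
      sup_le_sup_left (Ideal.span_singleton_le_span_singleton.2 (pow_dvd_pow a n.le_succ)) J
    let mulPow : A →ₗ[A] (J ⊔ Ideal.span {a ^ n} : Ideal A) := LinearMap.toSpanSingleton A _
      ⟨a ^ n, Ideal.mem_sup_right (Ideal.mem_span_singleton_self _)⟩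
    have hmulPow : J ⊔ Ideal.span {a} ≤
        Submodule.comap mulPow (Submodule.comap (Submodule.subtype _)
          (J ⊔ Ideal.span {a ^ (n + 1)})) := by
      refine sup_le (fun x hx => ?_) ((Ideal.span_singleton_le_iff_mem _).2 ?_)
      · exact Ideal.mem_sup_left (J.mul_mem_right _ hx)
      · exact Ideal.mem_sup_right (Ideal.mem_span_singleton.2 (pow_succ' a n).dvd)
    have hsurj : Function.Surjective (Submodule.mapQ _ _ mulPow hmulPow) := by
      intro y
      obtain ⟨⟨y, hy⟩, rfl⟩ := Submodule.Quotient.mk_surjective _ y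
      obtain ⟨c, j, hj, rfl⟩ := Ideal.mem_span_singleton_sup.1 (sup_comm J _ ▸ hy)
      refine ⟨Submodule.Quotient.mk c, (Submodule.Quotient.eq _).2 (Ideal.mem_sup_left ?_)⟩
      change c * a ^ n - (c * a ^ n + j) ∈ J
      rwa [sub_add_cancel_left, neg_mem_iff]
    rw [length_quotient_eq_add_of_le hle, Nat.cast_succ, add_one_mul, add_comm]
    exact add_le_add ih (Module.length_le_of_surjective _ hsurj)

theorem length_quotient_sup_span_image_pow_le (J : Ideal A) (s : Finset A) (n : ℕ) :
    Module.length A (A ⧸ J ⊔ Ideal.span ((· ^ n) '' (s : Set A))) ≤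
      (n ^ s.card : ℕ) * Module.length A (A ⧸ J ⊔ Ideal.span (s : Set A)) := by
  classical
  induction s using Finset.induction_on generalizing J with
  | empty =>
    rw [Finset.coe_empty, Set.image_empty, Finset.card_empty, pow_zero, Nat.cast_one, one_mul]
  | insert a s ha ih =>
    have hinsert (x : A) (t : Set A) :
        J ⊔ Ideal.span (insert x t) = (J ⊔ Ideal.span {x}) ⊔ Ideal.span t := by
      rw [Ideal.span_insert, sup_assoc]
    rw [Finset.coe_insert, Set.image_insert_eq, hinsert, hinsert, Finset.card_insert_of_notMem ha]
    calc
      _ ≤ (n ^ s.card : ℕ) *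
          Module.length A (A ⧸ (J ⊔ Ideal.span {a ^ n}) ⊔ Ideal.span (s : Set A)) := ih _
      _ ≤ (n ^ s.card : ℕ) *
          (n * Module.length A (A ⧸ (J ⊔ Ideal.span {a}) ⊔ Ideal.span (s : Set A))) := by
        gcongr
        rw [sup_right_comm, sup_right_comm J (Ideal.span {a})]
        exact length_quotient_sup_span_pow_le _ a n
      _ = _ := by push_cast; ring

end Length

namespace AssocGraded

variable {A : Type u} [CommRing A] {I : Ideal A}

theorem sum_length_piece (M : Type*) [AddCommGroup M] [Module A M] (n : ℕ) :
    ∑ l : Fin n, Module.length A (Piece I M l) = Module.length A (M ⧸ powSMul I M n) := by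
  induction n with
  | zero =>
    have : Subsingleton (M ⧸ powSMul I M 0) :=
      Submodule.Quotient.subsingleton_iff.2 (eq_top_iff.2 fun x _ => mem_powSMul_zero x)
    simp [Module.length_eq_zero]
  | succ n ih =>
    rw [Fin.sum_univ_castSucc, length_quotient_eq_add_of_le
      (Submodule.pow_smul_top_le I M n.le_succ), add_comm]
    exact congrArg _ ih

theorem card_le_length_of_mem_degreeLE (hI : I.IsMaximal) {κ : Type*} [Fintype κ]
    {v : κ → AssocGradedRing I} (hv : LinearIndependent (A ⧸ I) v) {n : ℕ}
    (hn : ∀ k, v k ∈ degreeLE (Piece I A) n) :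
    (Fintype.card κ : ℕ∞) ≤ Module.length A (A ⧸ powSMul I A (n + 1)) := by
  have : IsSimpleModule A (A ⧸ I) := isSimpleModule_iff_isCoatom.2 hI.out
  let combination : (κ → A ⧸ I) →ₗ[A] AssocGradedRing I :=
    (Fintype.linearCombination (A ⧸ I) v).restrictScalars A
  let truncation : (⨁ l, Piece I A l) →ₗ[A] ∀ l : Fin (n + 1), Piece I A l :=
    LinearMap.pi fun l => component A ℕ (Piece I A) l
  have hmem (c) : combination c ∈ degreeLE (Piece I A) n := by
    have (k : κ) : c k • v k ∈ degreeLE (Piece I A) n := by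
      obtain ⟨a, ha⟩ := Ideal.Quotient.mk_surjective (c k)
      have hsmul : c k • v k = a • v k := by
        rw [← ha, ← algebraMap_smul (A ⧸ I) a (v k)]
        rfl
      intro l hl
      rw [hsmul]
      exact (congrArg (a • ·) (hn k l hl)).trans (smul_zero a)
    exact (Fintype.linearCombination_apply (A ⧸ I) v c).symm ▸ sum_mem fun k _ => this k
  have hinj : Function.Injective (truncation ∘ₗ combination) := by
    refine (injective_iff_map_eq_zero _).2 fun c hc => ?_
    refine funext (Fintype.linearIndependent_iff.1 hv c (DFinsupp.ext fun l => ?_))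
    by_cases hl : l < n + 1
    · exact congrFun hc ⟨l, hl⟩
    · exact hmem c l (by omega)
  calc
    (Fintype.card κ : ℕ∞) = Module.length A (κ → A ⧸ I) := by
      simp [Module.length_pi_of_fintype]
    _ ≤ Module.length A (∀ l : Fin (n + 1), Piece I A l) := Module.length_le_of_injective _ hinj
    _ = Module.length A (A ⧸ powSMul I A (n + 1)) := by
      rw [Module.length_pi_of_fintype A fun l : Fin (n + 1) => Piece I A l, sum_length_piece]

theorem ringKrullDim_le_card [IsNoetherianRing A] (hI : I.IsMaximal) {s : Finset A}
    (hsI : (s : Set A) ⊆ I) (hs : Module.length A (A ⧸ Ideal.span (s : Set A)) ≠ ⊤) :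
    ringKrullDim (AssocGradedRing I) ≤ s.card := by
  let := Ideal.Quotient.field I
  have : SetLike.GradedMonoid (S := AddSubmonoid (AssocGradedRing I)) (degreeLE (Piece I A)) :=
    inferInstanceAs (SetLike.GradedMonoid (degreeLE (Piece I A)))
  obtain ⟨L, hL⟩ := ENat.ne_top_iff_exists.1 hs
  refine ringKrullDim_le_of_forall_card_le (k := A ⧸ I) (B := AssocGradedRing I) (L := L)
    (degreeLE (Piece I A)) degreeLE_mono exists_mem_degreeLE fun κ _ v n hv hn => ?_
  have hle : Ideal.span ((· ^ (n + 1)) '' (s : Set A)) ≤ powSMul I A (n + 1) := by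
    rw [powSMul, smul_eq_mul, Ideal.mul_top]
    exact Ideal.span_le.2 (Set.image_subset_iff.2 fun x hx => Ideal.pow_mem_pow (hsI hx) _)
  have h : (Fintype.card κ : ℕ∞) ≤ ((n + 1) ^ s.card : ℕ) * (L : ℕ∞) := calc
    _ ≤ Module.length A (A ⧸ powSMul I A (n + 1)) := card_le_length_of_mem_degreeLE hI hv hn
    _ ≤ Module.length A (A ⧸ Ideal.span ((· ^ (n + 1)) '' (s : Set A))) :=
      Module.length_le_of_surjective _ (Submodule.factor_surjective hle)
    _ ≤ ((n + 1) ^ s.card : ℕ) * L := by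
      have := length_quotient_sup_span_image_pow_le ⊥ s (n + 1)
      rwa [bot_sup_eq, bot_sup_eq, ← hL] at this
  exact_mod_cast h

theorem ringKrullDim_maximalIdeal_le [IsLocalRing A] [IsNoetherianRing A] :
    ringKrullDim (AssocGradedRing (IsLocalRing.maximalIdeal A)) ≤ ringKrullDim A := by
  obtain ⟨s, hs, hcard⟩ := Ideal.exists_finset_card_eq_height_of_isNoetherianRing
    (IsLocalRing.maximalIdeal A)
  have := IsLocalRing.quotient_artinian_of_mem_minimalPrimes_of_isLocalRing _ hs
  have hlength : Module.length A (A ⧸ Ideal.span (s : Set A)) ≠ ⊤ := by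
    rw [Module.length_eq_of_surjective (R := A ⧸ Ideal.span (s : Set A))
      Ideal.Quotient.mk_surjective]
    exact Module.length_ne_top
  rw [← IsLocalRing.maximalIdeal_height_eq_ringKrullDim (R := A), ← hcard]
  exact ringKrullDim_le_card inferInstance (Ideal.span_le.1 hs.1.2) hlength

end AssocGraded

section Ext

open CategoryTheory Abelian

variable {A : Type u} [CommRing A]

section Syzygy

variable {F N : Type u} [AddCommGroup F] [Module A F] [AddCommGroup N] [Module A N]

theorem shortExact_subtype_ker {π : F →ₗ[A] N} (hπ : Function.Surjective π) :
    (ShortComplex.mk (ModuleCat.ofHom (LinearMap.ker π).subtype) (ModuleCat.ofHom π)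
      (by ext x; exact x.2)).ShortExact where
  exact := (ShortComplex.ShortExact.moduleCat_exact_iff_function_exact _).2
    (LinearMap.exact_subtype_ker_map π)
  mono_f := (ModuleCat.mono_iff_injective _).2 (Submodule.subtype_injective _)
  epi_g := (ModuleCat.epi_iff_surjective _).2 hπ

theorem exists_comp_eq_smul_of_notMem_support_ext {M : Type u} [AddCommGroup M] [Module A M]
    {π : F →ₗ[A] N} (hπ : Function.Surjective π) {p : PrimeSpectrum A}
    (hp : p ∉ Module.support A (Ext (ModuleCat.of A M) (ModuleCat.of A (LinearMap.ker π)) 1))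
    (φ : M →ₗ[A] N) : ∃ c ∉ p.asIdeal, ∃ Φ : M →ₗ[A] F, π ∘ₗ Φ = c • φ := by
  have hS := shortExact_subtype_ker hπ
  obtain ⟨c, hc, hcφ⟩ := Module.notMem_support_iff'.1 hp
    ((Ext.mk₀ (ModuleCat.ofHom φ)).comp hS.extClass (zero_add 1))
  rw [← Ext.smul_comp, ← Ext.mk₀_smul] at hcφ
  obtain ⟨x, hx⟩ := Ext.covariant_sequence_exact₃ _ hS _ _ hcφ
  rw [← Ext.mk₀_homEquiv₀_apply x, Ext.mk₀_comp_mk₀] at hx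
  exact ⟨c, hc, (Ext.homEquiv₀ x).hom,
    congrArg ModuleCat.Hom.hom ((Ext.mk₀_bijective _ _).1 hx)⟩

end Syzygy

theorem nontrivial_of_mem_support_ext {M N : Type u} [AddCommGroup M] [Module A M]
    [AddCommGroup N] [Module A N] {n : ℕ} {p : PrimeSpectrum A}
    (hp : p ∈ Module.support A (Ext (ModuleCat.of A M) (ModuleCat.of A N) n)) : Nontrivial M := by
  by_contra h
  have := not_nontrivial_iff_subsingleton.1 h
  obtain ⟨e, he⟩ := Module.mem_support_iff'.1 hp
  have hid : 𝟙 (ModuleCat.of A M) = 0 := (ModuleCat.isZero_of_subsingleton _).eq_of_src _ _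
  refine he 1 p.2.one_notMem ?_
  rw [one_smul, ← Ext.mk₀_id_comp e, hid, Ext.mk₀_zero, Ext.zero_comp]

section QuotientPrime

variable {P : Ideal A} {F : Type u} [AddCommGroup F] [Module A F] {Q : Submodule A (A ⧸ P)}
  {π : F →ₗ[A] Q}

theorem apply_mem_of_apply_eq_zero {β : F →ₗ[A] A}
    (hβ : P.mkQ ∘ₗ β = Q.subtype ∘ₗ π) {k : F} (hk : π k = 0) : β k ∈ P := by
  have h := LinearMap.congr_fun hβ k
  simp only [LinearMap.comp_apply, hk, map_zero] at h
  exact (Submodule.Quotient.mk_eq_zero P).1 h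

theorem apply_smul_eq_zero (e : F) {q : A} (hq : q ∈ P) : π (q • e) = 0 := by
  obtain ⟨c, hc⟩ := Ideal.Quotient.mk_surjective (π e : A ⧸ P)
  refine Subtype.ext ?_
  rw [map_smul, Submodule.coe_smul, ← hc]
  exact Ideal.Quotient.eq_zero_iff_mem.2 (P.mul_mem_right c hq)

/-- The map `θ` is the composite `P → ker π → F → A`, where the outer maps are `q ↦ q • e` and
`β`, and the middle one lifts, up to the factor `c`, the map `ker π → Q` sending `k` to
`l (β k) * β e`. -/
theorem exists_mk_apply_eq_of_notMem_support_ext [hP : P.IsPrime] (hπ : Function.Surjective π)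
    (h : (⟨P, hP⟩ : PrimeSpectrum A) ∉ Module.support A
      (Ext (ModuleCat.of A (LinearMap.ker π)) (ModuleCat.of A (LinearMap.ker π)) 1))
    {β : F →ₗ[A] A} (hβ : P.mkQ ∘ₗ β = Q.subtype ∘ₗ π) (e : F) (l : P →ₗ[A] A ⧸ P) :
    ∃ c ∉ P, ∃ θ : P →ₗ[A] A, ∀ q, Ideal.Quotient.mk P (θ q) =
      Ideal.Quotient.mk P (c * β e * β e) * l q := by
  have hβ' (x : F) : Ideal.Quotient.mk P (β x) = π x := LinearMap.congr_fun hβ x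
  let σ : LinearMap.ker π →ₗ[A] P :=
    (β ∘ₗ (LinearMap.ker π).subtype).codRestrict P fun k => apply_mem_of_apply_eq_zero hβ k.2
  let τ : P →ₗ[A] LinearMap.ker π :=
    (LinearMap.toSpanSingleton A F e ∘ₗ P.subtype).codRestrict _
      fun q => apply_smul_eq_zero e q.2
  let κ : (A ⧸ P) →ₗ[A] Q := (LinearMap.mulRight A (π e : A ⧸ P)).codRestrict Q fun y => by
    obtain ⟨y, rfl⟩ := Ideal.Quotient.mk_surjective y
    exact Q.smul_mem y (π e).2
  obtain ⟨c, hc, Φ, hΦ⟩ := exists_comp_eq_smul_of_notMem_support_ext hπ h (κ ∘ₗ l ∘ₗ σ)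
  refine ⟨c, hc, β ∘ₗ Φ ∘ₗ τ, fun q => ?_⟩
  have hστ : σ (τ q) = β e • q := Subtype.ext ((map_smul β _ _).trans (mul_comm _ _))
  calc Ideal.Quotient.mk P (β (Φ (τ q)))
    _ = (π (Φ (τ q)) : A ⧸ P) := hβ' _
    _ = c • (l (σ (τ q)) * π e) := congrArg Subtype.val (LinearMap.congr_fun hΦ (τ q))
    _ = Ideal.Quotient.mk P c * (Ideal.Quotient.mk P (β e) * l q * Ideal.Quotient.mk P (β e)) := by
      rw [hστ, map_smul, hβ', Algebra.smul_def, Algebra.smul_def, Ideal.Quotient.algebraMap_eq,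
        hβ']
    _ = Ideal.Quotient.mk P (c * β e * β e) * l q := by
      rw [map_mul, map_mul]
      ring

theorem exists_apply_notMem_of_notMem_support_ext [hP : P.IsPrime] [Module.Projective A F]
    (hQ : Q ≠ ⊥) (hπ : Function.Surjective π)
    (h : (⟨P, hP⟩ : PrimeSpectrum A) ∉ Module.support A
      (Ext (ModuleCat.of A (LinearMap.ker π)) (ModuleCat.of A (LinearMap.ker π)) 1))
    {l : P →ₗ[A] A ⧸ P} {q : P} (hl : l q ≠ 0) : ∃ θ : P →ₗ[A] A, θ q ∉ P := by
  obtain ⟨y, hyQ, hy⟩ := Q.exists_mem_ne_zero_of_ne_bot hQ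
  obtain ⟨e, he⟩ := hπ ⟨y, hyQ⟩
  obtain ⟨β, hβ⟩ := Module.projective_lifting_property P.mkQ (Q.subtype ∘ₗ π) P.mkQ_surjective
  have hβe : β e ∉ P := fun hmem => hy <| by
    have := LinearMap.congr_fun hβ e
    rw [LinearMap.comp_apply, LinearMap.comp_apply, he] at this
    exact this.symm.trans ((Submodule.Quotient.mk_eq_zero P).2 hmem)
  obtain ⟨c, hc, θ, hθ⟩ := exists_mk_apply_eq_of_notMem_support_ext hπ h hβ e l
  refine ⟨θ, fun hmem => ?_⟩
  rw [← Ideal.Quotient.eq_zero_iff_mem, hθ, mul_eq_zero, Ideal.Quotient.eq_zero_iff_mem] at hmem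
  exact hmem.elim (hP.mul_notMem (hP.mul_notMem hc hβe) hβe) hl

end QuotientPrime

end Ext

section Regular

open IsLocalRing

theorem isRegularLocalRing_of_maximalIdeal_eq_span_singleton {R : Type*} [CommRing R]
    [IsLocalRing R] [IsNoetherianRing R] {t : R} (ht : maximalIdeal R = Ideal.span {t})
    (hreg : IsSMulRegular R t) : IsRegularLocalRing R := by
  have htm : t ∈ maximalIdeal R := ht ▸ Ideal.mem_span_singleton_self t
  have hrank : (maximalIdeal R).spanFinrank ≤ 1 := by
    rw [ht, ← Set.ncard_singleton t]
    exact Submodule.spanFinrank_span_le_ncard_of_finite (Set.finite_singleton t)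
  have : Nontrivial (R ⧸ Ideal.span {t}) :=
    Ideal.Quotient.nontrivial_iff.2 (ht ▸ Ideal.IsPrime.ne_top')
  refine IsRegularLocalRing.of_spanFinrank_maximalIdeal_le _ ?_
  calc ((maximalIdeal R).spanFinrank : WithBot ℕ∞)
    _ ≤ 0 + 1 := by exact_mod_cast hrank
    _ ≤ ringKrullDim (R ⧸ Ideal.span {t}) + 1 := by
      gcongr
      exact ringKrullDim_nonneg_of_nontrivial
    _ = ringKrullDim R := ringKrullDim_quotient_span_singleton_succ_eq_ringKrullDim hreg htm

variable {A : Type*} [CommRing A] {P : Ideal A}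

theorem linearMap_apply_mul_comm (θ : P →ₗ[A] A) (p q : P) : θ p * q = p * θ q := by
  rw [mul_comm, ← smul_eq_mul, ← map_smul, ← smul_eq_mul, ← map_smul]
  exact congrArg θ (Subtype.ext (mul_comm _ _))

variable [P.IsPrime]

theorem isRegularLocalRing_localization_of_forall_mul_eq_zero {r : A} (hr : r ∉ P)
    (h : ∀ a ∈ P, r * a = 0) : IsRegularLocalRing (Localization.AtPrime P) := by
  have hmax : maximalIdeal (Localization.AtPrime P) = ⊥ := by
    rw [← Localization.AtPrime.map_eq_maximalIdeal, eq_bot_iff, Ideal.map_le_iff_le_comap]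
    intro a ha
    exact (IsLocalization.map_eq_zero_iff P.primeCompl _ a).2 ⟨⟨r, hr⟩, h a ha⟩
  let : Field (Localization.AtPrime P) := (isField_iff_maximalIdeal_eq.2 hmax).toField
  infer_instance

variable {θ : P →ₗ[A] A} {p : P}

theorem maximalIdeal_localization_eq_span_of_apply_notMem (h : θ p ∉ P) :
    maximalIdeal (Localization.AtPrime P) =
      Ideal.span {algebraMap A (Localization.AtPrime P) p} := by
  have hunit : IsUnit (algebraMap A (Localization.AtPrime P) (θ p)) :=
    IsLocalization.map_units _ (⟨θ p, h⟩ : P.primeCompl)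
  rw [← Localization.AtPrime.map_eq_maximalIdeal]
  refine le_antisymm (Ideal.map_le_iff_le_comap.2 fun q hq => ?_)
    ((Ideal.span_singleton_le_iff_mem _).2 (Ideal.mem_map_of_mem _ p.2))
  rw [Ideal.mem_comap, Ideal.mem_span_singleton, ← hunit.dvd_mul_left, ← map_mul,
    linearMap_apply_mul_comm θ p ⟨q, hq⟩, map_mul]
  exact dvd_mul_right _ _

theorem isSMulRegular_localization_of_apply_notMem (h : θ p ∉ P) :
    IsSMulRegular (Localization.AtPrime P) (algebraMap A (Localization.AtPrime P) p) := by
  refine IsSMulRegular.of_right_eq_zero_of_smul fun x hx => ?_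
  obtain ⟨a, d, rfl⟩ := IsLocalization.exists_mk'_eq P.primeCompl x
  rw [smul_eq_mul, IsLocalization.mul_mk'_eq_mk'_of_mul, IsLocalization.mk'_eq_zero_iff] at hx
  obtain ⟨c, hc⟩ := hx
  have hcap : ((c : A) * a) • p = 0 := Subtype.ext <| by
    rw [Submodule.coe_smul, smul_eq_mul, mul_assoc, mul_comm a, hc, Submodule.coe_zero]
  have hθ : (c : A) * a * θ p = 0 := by
    rw [← smul_eq_mul, ← map_smul, hcap, map_zero]
  rw [IsLocalization.mk'_eq_zero_iff]
  exact ⟨c * ⟨θ p, h⟩, (mul_right_comm _ _ _).trans hθ⟩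

theorem isRegularLocalRing_localization_of_apply_notMem [IsNoetherianRing A] (h : θ p ∉ P) :
    IsRegularLocalRing (Localization.AtPrime P) :=
  isRegularLocalRing_of_maximalIdeal_eq_span_singleton
    (maximalIdeal_localization_eq_span_of_apply_notMem h)
    (isSMulRegular_localization_of_apply_notMem h)

theorem isRegularLocalRing_localization_of_subsingleton_linearMap [IsNoetherianRing A]
    [Subsingleton (P →ₗ[A] A ⧸ P)] : IsRegularLocalRing (Localization.AtPrime P) := by
  obtain ⟨r, hr, hreg⟩ := IsSMulRegular.subsingleton_linearMap_iff.1
    (inferInstance : Subsingleton (P →ₗ[A] A ⧸ P))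
  refine isRegularLocalRing_localization_of_forall_mul_eq_zero (r := r) (fun hrP => ?_)
    fun a ha => congrArg Subtype.val (Module.mem_annihilator.1 hr ⟨a, ha⟩)
  refine one_ne_zero (α := A ⧸ P) (hreg.right_eq_zero_of_smul ?_)
  rw [Algebra.smul_def, mul_one]
  exact Ideal.Quotient.eq_zero_iff_mem.2 hrP

end Regular

open CategoryTheory Abelian in
theorem mem_support_ext_ker_of_not_isRegularLocalRing {A : Type u} [CommRing A]
    [IsNoetherianRing A] {P : Ideal A} [hP : P.IsPrime]
    (hreg : ¬ IsRegularLocalRing (Localization.AtPrime P)) {Q : Submodule A (A ⧸ P)} (hQ : Q ≠ ⊥)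
    {F : Type u} [AddCommGroup F] [Module A F] [Module.Projective A F] {π : F →ₗ[A] Q}
    (hπ : Function.Surjective π) :
    (⟨P, hP⟩ : PrimeSpectrum A) ∈ Module.support A
      (Ext (ModuleCat.of A (LinearMap.ker π)) (ModuleCat.of A (LinearMap.ker π)) 1) := by
  contrapose! hreg with h
  by_cases hl : ∃ (l : P →ₗ[A] A ⧸ P) (q : P), l q ≠ 0
  · obtain ⟨l, q, hlq⟩ := hl
    obtain ⟨θ, hθ⟩ := exists_apply_notMem_of_notMem_support_ext hQ hπ h hlq
    exact isRegularLocalRing_localization_of_apply_notMem hθ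
  · push Not at hl
    have : Subsingleton (P →ₗ[A] A ⧸ P) :=
      subsingleton_of_forall_eq 0 fun l => LinearMap.ext (hl l)
    exact isRegularLocalRing_localization_of_subsingleton_linearMap

theorem one_le_supportDim_of_mem_support {A : Type*} [CommRing A] {M : Type*} [AddCommGroup M]
    [Module A M] {p q : PrimeSpectrum A} (hp : p ∈ Module.support A M) (hpq : p < q) :
    1 ≤ Module.supportDim A M :=
  Order.one_le_krullDim_iff.2 ⟨⟨p, hp⟩, ⟨q, Module.mem_support_mono hpq.le hp⟩, hpq⟩

theorem AssocGraded.mem_powSMul_pow_smul_top_iff {A : Type*} [CommRing A] {I : Ideal A}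
    {N : Type*} [AddCommGroup N] [Module A N] {n j : ℕ} {u : (I ^ n • ⊤ : Submodule A N)} :
    u ∈ powSMul I (I ^ n • ⊤ : Submodule A N) j ↔ (u : N) ∈ powSMul I N (n + j) := by
  rw [powSMul, Submodule.mem_smul_top_iff, powSMul, add_comm, pow_add, mul_smul]

theorem exists_pow_forall_isCohenMacaulay_ker {A : Type u} [CommRing A] [IsNoetherianRing A]
    {I : Ideal A} (hG : IsCohenMacaulay (AssocGradedRing I) (AssocGradedRing I))
    (hdim : ringKrullDim (AssocGradedRing I) ≤ 2) (N : Type*) [AddCommGroup N] [Module A N]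
    [Module.Finite A N] :
    ∃ n, ∀ (ι : Type) [Finite ι] (π : (ι → A) →ₗ[A] (I ^ n • ⊤ : Submodule A N)),
      Function.Surjective π → LinearMap.ker π ≤ I • ⊤ →
        IsCohenMacaulay (AssocGradedRing I) (AssocGradedModule I (LinearMap.ker π)) := by
  obtain ⟨n₁, hn₁⟩ := exists_forall_mem_pow_succ_smul_of_forall_smul_mem I N
  obtain ⟨n₂, hn₂⟩ := exists_forall_isLinearRelations_ker.{u} I N
  refine ⟨max n₁ n₂, fun ι _ π hπ hker => AssocGraded.isCohenMacaulay_ker hG hdim hπ ?_ ?_⟩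
  · have hrange : LinearMap.range (Submodule.subtype _ ∘ₗ π) = I ^ max n₁ n₂ • ⊤ := by
      rw [LinearMap.range_comp_of_range_eq_top _ (LinearMap.range_eq_top.2 hπ),
        Submodule.range_subtype]
    have hker' := LinearMap.ker_comp_of_ker_eq_bot π (Submodule.ker_subtype (I ^ max n₁ n₂ • ⊤))
    exact hker' ▸ hn₂ _ (le_max_right _ _) (ι → A) _ hrange (hker'.trans_le hker)
  · intro j u hu hIu
    rw [AssocGraded.mem_powSMul_pow_smul_top_iff] at hu ⊢
    refine hn₁ _ (le_add_right (le_max_left _ _)) _ hu fun a ha => ?_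
    exact AssocGraded.mem_powSMul_pow_smul_top_iff.1 (hIu a ha)

theorem pow_smul_top_quotient_ne_bot {A : Type*} [CommRing A] {P I : Ideal A} [hP : P.IsPrime]
    (hPI : P < I) (n : ℕ) : I ^ n • (⊤ : Submodule A (A ⧸ P)) ≠ ⊥ := by
  obtain ⟨a, haI, haP⟩ := SetLike.exists_of_lt hPI
  have hmem : a ^ n • (1 : A ⧸ P) ∈ I ^ n • (⊤ : Submodule A (A ⧸ P)) :=
    Submodule.smul_mem_smul (Ideal.pow_mem_pow haI n) trivial
  intro hbot
  rw [hbot, Submodule.mem_bot, Algebra.smul_def, mul_one] at hmem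
  exact haP (hP.mem_of_pow_mem n (Ideal.Quotient.eq_zero_iff_mem.1 hmem))

theorem eq_of_mem_associatedPrimes_submodule_quotient {A : Type*} [CommRing A] {P p : Ideal A}
    [hP : P.IsPrime] {Q : Submodule A (A ⧸ P)} (hp : p ∈ associatedPrimes A Q) : p = P :=
  (IsAssociatedPrime.eq_radical hP.isPrimary
    (associatedPrimes.subset_of_injective Q.subtype_injective hp)).trans hP.radical

open IsLocalRing in
theorem proposition9_general {A : Type u} [CommRing A] [IsLocalRing A] [IsNoetherianRing A]
    (hdim : ringKrullDim A ≤ 2) (hCM : IsLocalCohenMacaulay A A)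
    (hG : IsCohenMacaulay (AssocGradedRing (maximalIdeal A)) (AssocGradedRing (maximalIdeal A)))
    (hsing : ¬ IsIsolatedSingularity A) :
    ∃ M : ModuleCat.{u} A, IsMaximalCohenMacaulay A M ∧
      IsCohenMacaulay (AssocGradedRing (maximalIdeal A))
        (AssocGradedModule (maximalIdeal A) M) ∧
      1 ≤ Module.supportDim A (CategoryTheory.Abelian.Ext M M 1) := by
  obtain ⟨P, hP, hPm, hreg⟩ : ∃ (P : Ideal A) (_ : P.IsPrime), P ≠ maximalIdeal A ∧
      ¬ IsRegularLocalRing (Localization.AtPrime P) := by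
    simpa only [IsIsolatedSingularity, not_forall, exists_prop] using hsing
  have hPlt : P < maximalIdeal A := (le_maximalIdeal hP.ne_top).lt_of_ne hPm
  obtain ⟨n, hn⟩ := exists_pow_forall_isCohenMacaulay_ker hG
    (AssocGraded.ringKrullDim_maximalIdeal_le.trans hdim) (A ⧸ P)
  let Q : Submodule A (A ⧸ P) := maximalIdeal A ^ n • ⊤
  obtain ⟨s, π, hπ, hker⟩ := exists_surjective_ker_le_maximalIdeal_smul_top A Q
  have hExt := mem_support_ext_ker_of_not_isRegularLocalRing hreg
    (pow_smul_top_quotient_ne_bot hPlt n) hπ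
  have := nontrivial_of_mem_support_ext hExt
  obtain ⟨hdimM, hCMM⟩ := supportDim_eq_and_isLocalCohenMacaulay_of_syzygy hCM hdim
    (LinearMap.ker π).subtype_injective (LinearMap.exact_subtype_ker_map π)
    fun h => hPm (eq_of_mem_associatedPrimes_submodule_quotient h).symm
  have hfin : Module.Finite A (LinearMap.ker π) := inferInstance
  exact ⟨ModuleCat.of A (LinearMap.ker π), ⟨hfin, hCMM, hdimM⟩, hn (Fin s) π hπ hker,
    one_le_supportDim_of_mem_support hExt
      (q := ⟨maximalIdeal A, (maximalIdeal.isMaximal A).isPrime⟩) hPlt⟩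

theorem proposition9 {A : Type u} [CommRing A] [IsLocalRing A] [IsNoetherianRing A]
    (hdim : ringKrullDim A = 2) (hCM : IsLocalCohenMacaulay A A)
    (hG : IsCohenMacaulay (AssocGradedRing (IsLocalRing.maximalIdeal A))
      (AssocGradedRing (IsLocalRing.maximalIdeal A)))
    (hsing : ¬ IsIsolatedSingularity A) :
    ∃ M : ModuleCat.{u} A, IsMaximalCohenMacaulay A M ∧
      IsCohenMacaulay (AssocGradedRing (IsLocalRing.maximalIdeal A))
        (AssocGradedModule (IsLocalRing.maximalIdeal A) M) ∧
      1 ≤ Module.supportDim A (CategoryTheory.Abelian.Ext M M 1) :=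
  proposition9_general hdim.le hCM hG hsing
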